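/- Let $(X,d,\mu)$ be a metric space with a Borel measure, write $B(x,r)=\{y: d(x,y)<r\}$ and $V(x,r)=\mu(B(x,r))$, and suppose that $X$ is unbounded and AD-regular of dimension $n>0$: there is $C\ge 1$ with $C^{-1}r^n\le V(x,r)\le Cr^n$ for all $x\in X$ and $0<r<\operatorname{diam}(X)=\infty$. Let $X^+=X\times(0,\infty)$ with the measure $d\mu(y)\,dt/t$, let $L^0(X^+)$ be the space of measurable complex functions on $X^+$ (modulo null sets), and let $\Gamma(x)=\{(y,t)\in X^+: d(x,y)<t\}$. For $p,q\in(0,\infty)$, $s\in\mathbb R$ and $f\in L^0(X^+)$ put $$\|f\|_{T^{p,q}_s}=\Big(\int_X\Big(\iint_{\Gamma(x)}|V(y,t)^{-s}f(y,t)|^q\,\frac{d\mu(y)}{V(y,t)}\frac{dt}{t}\Big)^{p/q}d\mu(x)\Big)^{1/p},\qquad \|f\|_{L^q_s}=\Big(\iint_{X^+}|f|^q\,V(y,t)^{-qs}\,\frac{d\mu(y)}{V(y,t)}\frac{dt}{t}\Big)^{1/q},$$ and for $0\le a<b\le\infty$ let $f_{a,b}=\mathbf 1_{X\times(a,b)}f$.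 The real interpolation quasi-norm is $$\|g\|_{(L^q_{s_0},L^q_{s_1})_{\theta,p}}=\Big(\int_0^\infty\big(\alpha^{-\theta}K(\alpha,g)\big)^p\frac{d\alpha}{\alpha}\Big)^{1/p},\qquad K(\alpha,g)=\inf_{g=\varphi_0+\varphi_1}\big(\|\varphi_0\|_{L^q_{s_0}}+\alpha\|\varphi_1\|_{L^q_{s_1}}\big),$$ the infimum being over $\varphi_0,\varphi_1\in L^0(X^+)$. All these quantities take values in $[0,\infty]$. Let $p_0,p_1,q\in(0,\infty)$, $s_0\ne s_1$ in $\mathbb R$, $\theta\in(0,1)$ and $p_\theta^{-1}=(1-\theta)p_0^{-1}+\theta p_1^{-1}$. For $f\in L^0(X^+)$ put $$N(f)=\Big\|x\mapsto\|\mathbf 1_{\Gamma(x)}f\|_{(L^q_{s_0},L^q_{s_1})_{\theta,p_\theta}}\Big\|_{L^{p_\theta}(X)}.$$ Then the following equivalences hold for all $f\in L^0(X^+)$, with constants independent of $f$. (1) If $s_0<s_1$, then $$N(f)\simeq\Big\|\tau^{n(s_1-s_0)(1-\theta)}\|f_{\tau,\infty}\|_{T^{p_\theta,q}_{s_1}}\Big\|_{L^{p_\theta}(\mathbb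 R_+,d\tau/\tau)}\simeq\Big\|\tau^{-n(s_1-s_0)\theta}\|f_{0,\tau}\|_{T^{p_\theta,q}_{s_0}}\Big\|_{L^{p_\theta}(\mathbb R_+,d\tau/\tau)}.$$ (2) If $s_1<s_0$, the same holds with $(s_0,s_1,\theta)$ replaced by $(s_1,s_0,1-\theta)$ in the two truncation norms ($p_\theta$ unchanged), that is, $$N(f)\simeq\Big\|\tau^{n(s_0-s_1)\theta}\|f_{\tau,\infty}\|_{T^{p_\theta,q}_{s_0}}\Big\|_{L^{p_\theta}(\mathbb R_+,d\tau/\tau)}\simeq\Big\|\tau^{-n(s_0-s_1)(1-\theta)}\|f_{0,\tau}\|_{T^{p_\theta,q}_{s_1}}\Big\|_{L^{p_\theta}(\mathbb R_+,d\tau/\tau)}.$$ (3) In both cases, for every $r\in(1,\infty)$, with constants that may depend on $r$, $$N(f)\simeq_r\Big\|\big(r^{-nk\theta(s_1-s_0)}\,\|f_{r^{k-1},r^{k}}\|_{T^{p_\theta,q}_{s_0}}\big)_{k\in\mathbb Z}\Big\|_{\ell^{p_\theta}(\mathbb Z)}.$$ -/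

import Mathlib

open MeasureTheory Set Filter
open scoped ENNReal NNReal

noncomputable section

namespace TentSpace

variable {X : Type*} [MetricSpace X] [MeasurableSpace X]

/-- `(X, d, μ)` is Ahlfors–David regular of dimension `n`:
`C⁻¹ rⁿ ≤ μ (B(x, r)) ≤ C rⁿ` for all `x ∈ X` and `0 < r < diam X`. -/
def IsADRegular (μ : Measure X) (n : ℝ) : Prop :=
  0 < n ∧ ∃ C : ℝ, 1 ≤ C ∧ ∀ (x : X) (r : ℝ), 0 < r →
    ENNReal.ofReal r < Metric.ediam (univ : Set X) →
      ENNReal.ofReal (C⁻¹ * r ^ n) ≤ μ (Metric.ball x r) ∧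
        μ (Metric.ball x r) ≤ ENNReal.ofReal (C * r ^ n)

/-- The measure `dt / t` on `ℝ₊ = (0, ∞)`, regarded as a measure on `ℝ`. -/
def dtOverT : Measure ℝ :=
  (volume.restrict (Ioi (0 : ℝ))).withDensity fun t => ENNReal.ofReal t⁻¹

/-- The measure `dμ(y) dt / t` on the half-space `X⁺ = X × (0, ∞)`, regarded as a measure on
`X × ℝ`. -/
def halfSpace (μ : Measure X) : Measure (X × ℝ) :=
  μ.prod dtOverT

/-- `f ∈ L⁰(X⁺)`: the function `f` is (a.e. equal to) a measurable function on the half-space. -/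
def MemL0 (μ : Measure X) (f : X × ℝ → ℂ) : Prop :=
  AEStronglyMeasurable f (halfSpace μ)

/-- The `Lᵖ(ν)` quasi-norm `(∫ gᵖ dν)^(1/p)`, for `p ∈ (0, ∞)`, of a `[0, ∞]`-valued function. -/
def lpNorm {Z : Type*} [MeasurableSpace Z] (ν : Measure Z) (p : ℝ) (g : Z → ℝ≥0∞) : ℝ≥0∞ :=
  (∫⁻ z, g z ^ p ∂ν) ^ (1 / p)

/-- The cone `Γ(x) = {(y, t) ∈ X⁺ : d(x, y) < t}`. -/
def cone (x : X) : Set (X × ℝ) :=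
  {z | 0 < z.2 ∧ z.1 ∈ Metric.ball x z.2}

/-- The operator `V^s`, `(V^s f)(y, t) = V(y, t)^s f(y, t)`, where `V(y, t) = μ (B(y, t))`. -/
def volPow (μ : Measure X) (s : ℝ) (f : X × ℝ → ℂ) : X × ℝ → ℂ :=
  fun z => ((μ.real (Metric.ball z.1 z.2) ^ s : ℝ) : ℂ) * f z

/-- The Lusin-type functional
`A^q f(x) = (∬_{Γ(x)} |f(y, t)|^q dμ(y) / V(y, t) dt / t)^(1/q)`. -/
def lusin (μ : Measure X) (q : ℝ) (f : X × ℝ → ℂ) (x : X) : ℝ≥0∞ :=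
  (∫⁻ z in cone x, ‖f z‖ₑ ^ q / μ (Metric.ball z.1 z.2) ∂(halfSpace μ)) ^ (1 / q)

/-- The quasi-norm of the weighted tent space `T^{p,q}_s`, namely `‖A^q (V^{-s} f)‖_{Lᵖ(X)}`
(equal to `∞` for `f` outside that space). -/
def tentNorm (μ : Measure X) (p q s : ℝ) (f : X × ℝ → ℂ) : ℝ≥0∞ :=
  lpNorm μ p (lusin μ q (volPow μ (-s) f))

/-- The quasi-norm of
`L^q_s(X⁺) = L^q(X⁺, V(y, t)^{-qs} dμ(y) / V(y, t) dt / t)` (`∞` outside the space). -/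
def lqsNorm (μ : Measure X) (q s : ℝ) (g : X × ℝ → ℂ) : ℝ≥0∞ :=
  (∫⁻ z, ‖g z‖ₑ ^ q * μ (Metric.ball z.1 z.2) ^ (-q * s - 1) ∂(halfSpace μ)) ^ (1 / q)

/-- Peetre's `K`-functional
`K(α, g; A₀, A₁) = inf {‖φ₀‖_{A₀} + α ‖φ₁‖_{A₁} : g = φ₀ + φ₁}` for two spaces `A₀, A₁ ⊆ L⁰(ν)`
given by their quasi-norms `N₀, N₁` (which are `∞` outside the spaces). -/
def kFunctional {Z : Type*} [MeasurableSpace Z] (ν : Measure Z) (N₀ N₁ : (Z → ℂ) → ℝ≥0∞)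
    (α : ℝ) (g : Z → ℂ) : ℝ≥0∞ :=
  ⨅ (φ₀ : Z → ℂ) (φ₁ : Z → ℂ) (_ : AEStronglyMeasurable φ₀ ν) (_ : AEStronglyMeasurable φ₁ ν)
    (_ : g =ᵐ[ν] φ₀ + φ₁), N₀ φ₀ + ENNReal.ofReal α * N₁ φ₁

/-- The quasi-norm of the real interpolation space `(A₀, A₁)_{θ,p}`:
`(∫₀^∞ (α^{-θ} K(α, g; A₀, A₁))^p dα / α)^(1/p)`. -/
def realInterpNorm {Z : Type*} [MeasurableSpace Z] (ν : Measure Z) (N₀ N₁ : (Z → ℂ) → ℝ≥0∞)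
    (θ p : ℝ) (g : Z → ℂ) : ℝ≥0∞ :=
  lpNorm dtOverT p fun α => ENNReal.ofReal (α ^ (-θ)) * kFunctional ν N₀ N₁ α g

/-- The truncation `f_{a,b} = 1_{X × (a, b)} f`, for `a, b ∈ [0, ∞]`. -/
def truncate (a b : ℝ≥0∞) (f : X × ℝ → ℂ) : X × ℝ → ℂ :=
  {z : X × ℝ | a < ENNReal.ofReal z.2 ∧ ENNReal.ofReal z.2 < b}.indicator f

/-- `‖ x ↦ ‖1_{Γ(x)} f‖_{(L^q_{s₀}(X⁺), L^q_{s₁}(X⁺))_{θ,p}} ‖_{Lᵖ(X)}`. -/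
def coneInterpNorm (μ : Measure X) (p q s₀ s₁ θ : ℝ) (f : X × ℝ → ℂ) : ℝ≥0∞ :=
  lpNorm μ p fun x =>
    realInterpNorm (halfSpace μ) (lqsNorm μ q s₀) (lqsNorm μ q s₁) θ p ((cone x).indicator f)

/-- `‖ τ^{n(s₁-s₀)(1-θ)} ‖f_{τ,∞}‖_{T^{p,q}_{s₁}} ‖_{Lᵖ(ℝ₊, dτ/τ)}`. -/
def upperTruncNorm (μ : Measure X) (n p q s₀ s₁ θ : ℝ) (f : X × ℝ → ℂ) : ℝ≥0∞ :=
  lpNorm dtOverT p fun τ =>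
    ENNReal.ofReal (τ ^ (n * (s₁ - s₀) * (1 - θ))) *
      tentNorm μ p q s₁ (truncate (ENNReal.ofReal τ) ∞ f)

/-- `‖ τ^{-n(s₁-s₀)θ} ‖f_{0,τ}‖_{T^{p,q}_{s₀}} ‖_{Lᵖ(ℝ₊, dτ/τ)}`. -/
def lowerTruncNorm (μ : Measure X) (n p q s₀ s₁ θ : ℝ) (f : X × ℝ → ℂ) : ℝ≥0∞ :=
  lpNorm dtOverT p fun τ =>
    ENNReal.ofReal (τ ^ (-(n * (s₁ - s₀) * θ))) *
      tentNorm μ p q s₀ (truncate 0 (ENNReal.ofReal τ) f)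

/-- `‖ (r^{-nkθ(s₁-s₀)} ‖f_{r^{k-1},r^k}‖_{T^{p,q}_{s₀}})_{k ∈ ℤ} ‖_{ℓᵖ(ℤ)}`. -/
def layerNorm (μ : Measure X) (n p q s₀ s₁ θ r : ℝ) (f : X × ℝ → ℂ) : ℝ≥0∞ :=
  (∑' k : ℤ, (ENNReal.ofReal (r ^ (-(n * k * θ * (s₁ - s₀)))) *
    tentNorm μ p q s₀
      (truncate (ENNReal.ofReal (r ^ (k - 1))) (ENNReal.ofReal (r ^ k)) f)) ^ p) ^ (1 / p)

/-- Equivalence `N ≃ M` of two `[0, ∞]`-valued quasi-norms on `L⁰(X⁺)`, with a constant that does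
not depend on the function. -/
def NormEquiv (μ : Measure X) (N M : (X × ℝ → ℂ) → ℝ≥0∞) : Prop :=
  ∃ C : ℝ≥0, 1 ≤ C ∧ ∀ f : X × ℝ → ℂ, MemL0 μ f → N f ≤ C * M f ∧ M f ≤ C * N f

end TentSpace

end

/-! Every quasi-norm in the statement is comparable to one and the same discrete expression,
`discreteNorm`: on the cone over x, sum over k the (p/q)-th powers of the integrals of |f|^q
t^{-n(σq+1)} over the layers r^{k-1} < t < r^k, then integrate in x. Here σ = (1-θ)s₀ + θs₁ and p =
p_θ.

By regularity V(y,t) may be replaced by t^n, so every weight becomes a power of t alone. The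
K-functional of two weighted L^q spaces is attained, up to constants, by giving each point to the
cheaper weight; this yields the L^q norm with weight min(W₀, α^q W₁) (`comparable_kFunctional`).
With α = τ^{n(s₁-s₀)} the two weights cross at t = τ. All the continuous quasi-norms then take the
form of an integral in x and dτ/τ of (∫_{Γ(x)} φ(t/τ) |f|^q t^{-n(σq+1)})^{p/q}. They differ only in
the kernel: the minimum of u^a and u^{-b} for interpolation, u^a cut off to u < 1 or u^{-b} cut off
to u > 1 for the truncations. The outer exponents in x and in τ agree, so Tonelli lets the two
integrals be exchanged.

The kernel itself hardly matters. If φ decays like a power at 0 and at ∞ and is bounded below on a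
window around one scale, the τ-average is comparable to the sum over layers
(`exists_comparable_lintegral_kernel_tsum_layers`). The upper bound is a discrete convolution
inequality with geometric weights, valid for every exponent p/q > 0; the lower bound keeps a single
window of τ for each layer. The layer norm needs no averaging, since t is comparable to r^k on the
k-th layer. -/

open MeasureTheory Set Filter
open scoped ENNReal NNReal

noncomputable section

namespace TentSpace

/-! ### Two-sided comparisons in `[0, ∞]` -/

/-- `a` and `b` are comparable with constant `C`. -/
def Comparable (C : ℝ≥0) (a b : ℝ≥0∞) : Prop :=
  a ≤ C * b ∧ b ≤ C * a

namespace Comparable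

variable {C D : ℝ≥0} {a b c d : ℝ≥0∞}

theorem rfl : Comparable 1 a a := by simp [Comparable]

theorem symm (h : Comparable C a b) : Comparable C b a := ⟨h.2, h.1⟩

theorem trans (h : Comparable C a b) (h' : Comparable D b c) : Comparable (C * D) a c := by
  constructor
  · calc a ≤ C * b := h.1
      _ ≤ C * (D * c) := by gcongr; exact h'.1
      _ = _ := by push_cast; ring
  · calc c ≤ D * b := h'.2
      _ ≤ D * (C * a) := by gcongr; exact h.2
      _ = _ := by push_cast; ring

theorem mul (h : Comparable C a b) (h' : Comparable D c d) :
    Comparable (C * D) (a * c) (b * d) := by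
  constructor
  · calc a * c ≤ (C * b) * (D * d) := by gcongr; exacts [h.1, h'.1]
      _ = _ := by push_cast; ring
  · calc b * d ≤ (C * a) * (D * c) := by gcongr; exacts [h.2, h'.2]
      _ = _ := by push_cast; ring

theorem mul_left (h : Comparable C a b) (c : ℝ≥0∞) : Comparable C (c * a) (c * b) := by
  simpa using (rfl (a := c)).mul h

theorem mono (h : Comparable C a b) (hCD : C ≤ D) : Comparable D a b := by
  have : (C : ℝ≥0∞) ≤ D := by exact_mod_cast hCD
  exact ⟨h.1.trans (by gcongr), h.2.trans (by gcongr)⟩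

theorem min (h : Comparable C a b) (h' : Comparable D c d) :
    Comparable (max C D) (min a c) (min b d) := by
  have h₁ := h.mono (le_max_left C D)
  have h₂ := h'.mono (le_max_right C D)
  constructor
  · rw [mul_min]
    exact min_le_min h₁.1 h₂.1
  · rw [mul_min]
    exact min_le_min h₁.2 h₂.2

theorem rpow (h : Comparable C a b) {p : ℝ} (hp : 0 ≤ p) :
    Comparable (C ^ p) (a ^ p) (b ^ p) := by
  constructor
  · calc a ^ p ≤ (C * b) ^ p := ENNReal.rpow_le_rpow h.1 hp
      _ = _ := by rw [ENNReal.mul_rpow_of_nonneg _ _ hp, ENNReal.coe_rpow_of_nonneg _ hp]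
  · calc b ^ p ≤ (C * a) ^ p := ENNReal.rpow_le_rpow h.2 hp
      _ = _ := by rw [ENNReal.mul_rpow_of_nonneg _ _ hp, ENNReal.coe_rpow_of_nonneg _ hp]

theorem inv_le_mul_inv (hC : 0 < C) (h : a ≤ C * b) : b⁻¹ ≤ C * a⁻¹ := by
  have hC' : (C : ℝ≥0∞) ≠ 0 := by exact_mod_cast hC.ne'
  calc b⁻¹ = C * (C * b)⁻¹ := by
        rw [ENNReal.mul_inv (Or.inl hC') (Or.inl ENNReal.coe_ne_top), ← mul_assoc,
          ENNReal.mul_inv_cancel hC' ENNReal.coe_ne_top, one_mul]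
    _ ≤ C * a⁻¹ := by gcongr

theorem inv (hC : 0 < C) (h : Comparable C a b) : Comparable C a⁻¹ b⁻¹ :=
  ⟨inv_le_mul_inv hC h.2, inv_le_mul_inv hC h.1⟩

/-- The volume weights occur with exponents of either sign. A negative power is the inverse of a
positive one, and inversion keeps the constant provided it is nonzero. -/
theorem rpow' (hC : 0 < C) (h : Comparable C a b) (e : ℝ) :
    Comparable (C ^ |e|) (a ^ e) (b ^ e) := by
  rcases le_total 0 e with he | he
  · rw [abs_of_nonneg he]
    exact h.rpow he
  · have := ((h.rpow (neg_nonneg.2 he)).inv (NNReal.rpow_pos hC))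
    rw [abs_of_nonpos he]
    simpa [ENNReal.rpow_neg] using this

/-- The constant is finite, so it leaves the integral without any measurability of the integrands.
-/
theorem lintegral {Z : Type*} [MeasurableSpace Z] {ν : Measure Z} {g h : Z → ℝ≥0∞}
    (H : ∀ᵐ z ∂ν, Comparable C (g z) (h z)) :
    Comparable C (∫⁻ z, g z ∂ν) (∫⁻ z, h z ∂ν) := by
  constructor
  · rw [← lintegral_const_mul' _ _ ENNReal.coe_ne_top]
    exact lintegral_mono_ae (H.mono fun z hz => hz.1)
  · rw [← lintegral_const_mul' _ _ ENNReal.coe_ne_top]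
    exact lintegral_mono_ae (H.mono fun z hz => hz.2)

theorem tsum {ι : Type*} {g h : ι → ℝ≥0∞} (H : ∀ i, Comparable C (g i) (h i)) :
    Comparable C (∑' i, g i) (∑' i, h i) := by
  constructor
  · rw [← ENNReal.tsum_mul_left]
    exact ENNReal.tsum_le_tsum fun i => (H i).1
  · rw [← ENNReal.tsum_mul_left]
    exact ENNReal.tsum_le_tsum fun i => (H i).2

end Comparable

section NormEquiv

variable {X : Type*} [MeasurableSpace X] {μ : Measure X}
  {N M K : (X × ℝ → ℂ) → ℝ≥0∞}

theorem normEquiv_of_comparable (C : ℝ≥0) (h : ∀ f, MemL0 μ f → Comparable C (N f) (M f)) :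
    NormEquiv μ N M :=
  ⟨max C 1, le_max_right _ _, fun f hf => (h f hf).mono (le_max_left _ _)⟩

theorem NormEquiv.symm (h : NormEquiv μ N M) : NormEquiv μ M N := by
  obtain ⟨C, hC, h⟩ := h
  exact ⟨C, hC, fun f hf => (h f hf).symm⟩

theorem NormEquiv.trans (h : NormEquiv μ N M) (h' : NormEquiv μ M K) : NormEquiv μ N K := by
  obtain ⟨C, -, h⟩ := h
  obtain ⟨D, -, h'⟩ := h'
  exact normEquiv_of_comparable (C * D) fun f hf =>
    Comparable.trans (show Comparable C _ _ from h f hf) (show Comparable D _ _ from h' f hf)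

end NormEquiv

/-! ### Ahlfors–David regular spaces -/

section ADRegular

variable {X : Type*} [MetricSpace X] [MeasurableSpace X] {μ : Measure X} {n : ℝ}

theorem IsADRegular.exists_comparable (h : IsADRegular μ n)
    (hX : ¬ Bornology.IsBounded (univ : Set X)) :
    ∃ C : ℝ≥0, 0 < C ∧ ∀ (x : X) (r : ℝ), 0 < r →
      Comparable C (μ (Metric.ball x r)) (ENNReal.ofReal (r ^ n)) := by
  obtain ⟨-, C, hC, H⟩ := h
  have hC0 : 0 < C := by linarith
  refine ⟨C.toNNReal, Real.toNNReal_pos.2 hC0, fun x r hr => ?_⟩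
  have hd : ENNReal.ofReal r < Metric.ediam (univ : Set X) := by
    rw [Metric.ediam_of_unbounded hX]
    exact ENNReal.ofReal_lt_top
  obtain ⟨h₁, h₂⟩ := H x r hr hd
  change _ ≤ ENNReal.ofReal C * _ ∧ _ ≤ ENNReal.ofReal C * _
  constructor
  · rwa [← ENNReal.ofReal_mul hC0.le]
  · calc ENNReal.ofReal (r ^ n) = ENNReal.ofReal C * ENNReal.ofReal (C⁻¹ * r ^ n) := by
          rw [← ENNReal.ofReal_mul hC0.le]
          congr 1
          field_simp
      _ ≤ _ := by gcongr

theorem IsADRegular.measure_ball_ne_top (h : IsADRegular μ n)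
    (hX : ¬ Bornology.IsBounded (univ : Set X)) (x : X) (r : ℝ) :
    μ (Metric.ball x r) ≠ ∞ := by
  rcases le_or_gt r 0 with hr | hr
  · simp [Metric.ball_eq_empty.2 hr]
  · obtain ⟨C, -, H⟩ := h.exists_comparable hX
    exact ne_top_of_le_ne_top (ENNReal.mul_ne_top ENNReal.coe_ne_top ENNReal.ofReal_ne_top)
      (H x r hr).1

theorem IsADRegular.measure_ball_pos (h : IsADRegular μ n)
    (hX : ¬ Bornology.IsBounded (univ : Set X)) (x : X) {r : ℝ} (hr : 0 < r) :
    0 < μ (Metric.ball x r) := by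
  obtain ⟨C, -, H⟩ := h.exists_comparable hX
  by_contra h0
  have := (H x r hr).2
  rw [nonpos_iff_eq_zero.1 (not_lt.1 h0), mul_zero, nonpos_iff_eq_zero,
    ENNReal.ofReal_eq_zero] at this
  exact absurd (Real.rpow_pos_of_pos hr n) (not_lt.2 this)

theorem IsADRegular.sigmaFinite (h : IsADRegular μ n)
    (hX : ¬ Bornology.IsBounded (univ : Set X)) : SigmaFinite μ := by
  have : Nonempty X := by
    by_contra hne
    rw [not_nonempty_iff] at hne
    exact hX (by simp [Set.eq_empty_of_isEmpty])
  obtain ⟨x⟩ := this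
  exact ⟨⟨⟨fun k : ℕ => Metric.ball x k, fun _ => trivial,
    fun k => (h.measure_ball_ne_top hX x k).lt_top, Metric.iUnion_ball_nat x⟩⟩⟩

theorem exists_maximal_disjoint_balls (X : Type*) [MetricSpace X] (ε : ℝ) :
    ∃ s : Set X, s.PairwiseDisjoint (fun x => Metric.ball x ε) ∧
      ∀ x, ∃ y ∈ s, ε ≤ 0 ∨ ¬ Disjoint (Metric.ball x ε) (Metric.ball y ε) := by
  obtain ⟨s, hs⟩ := zorn_subset {s : Set X | s.PairwiseDisjoint fun x => Metric.ball x ε} (by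
    intro c hc hchain
    exact ⟨⋃₀ c, (pairwiseDisjoint_sUnion hchain.directedOn).2 fun s hs => hc hs,
      fun s hs => subset_sUnion_of_mem hs⟩)
  refine ⟨s, hs.prop, fun x => ?_⟩
  by_contra! hx
  have hins : (insert x s).PairwiseDisjoint fun x => Metric.ball x ε :=
    hs.prop.insert fun y hy _ => (hx y hy).2
  have hxs : x ∈ s := hs.le_of_ge hins (subset_insert x s) (mem_insert x s)
  obtain ⟨h0, hd⟩ := hx x hxs
  exact absurd (Metric.mem_ball_self h0) (by rw [disjoint_self.1 hd]; simp)

/-- A maximal family of disjoint balls of radius ε/2 is countable, because the balls have positive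
measure and the measure is σ-finite; by maximality its centres are ε-dense. Separability makes the
distance measurable for the product σ-algebra, on which the measurability of cones and the uses of
Tonelli rest. -/
theorem IsADRegular.secondCountableTopology [BorelSpace X] (h : IsADRegular μ n)
    (hX : ¬ Bornology.IsBounded (univ : Set X)) : SecondCountableTopology X := by
  have := h.sigmaFinite hX
  refine Metric.secondCountable_of_almost_dense_set fun ε hε => ?_
  have hε2 : 0 < ε / 2 := by linarith
  obtain ⟨s, hs, hmax⟩ := exists_maximal_disjoint_balls X (ε / 2)
  refine ⟨s, ?_, fun x => ?_⟩
  · have := Measure.countable_meas_pos_of_disjoint_iUnion (μ := μ)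
      (As := fun x : s => Metric.ball (x : X) (ε / 2)) (fun _ => measurableSet_ball)
      (fun a b hab => hs a.2 b.2 fun h => hab (Subtype.ext h))
    have huniv : {i : s | 0 < μ (Metric.ball (i : X) (ε / 2))} = univ :=
      eq_univ_of_forall fun i => h.measure_ball_pos hX i hε2
    rw [huniv, countable_univ_iff] at this
    exact countable_coe_iff.1 this
  · obtain ⟨y, hy, hxy⟩ := hmax x
    obtain ⟨z, hz₁, hz₂⟩ := Set.not_disjoint_iff.1 (hxy.resolve_left (not_le.2 hε2))
    refine ⟨y, hy, ?_⟩
    have := dist_triangle_right x y z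
    rw [Metric.mem_ball, dist_comm] at hz₁ hz₂
    linarith

theorem IsADRegular.exists_comparable_rpow (h : IsADRegular μ n)
    (hX : ¬ Bornology.IsBounded (univ : Set X)) (e : ℝ) :
    ∃ C : ℝ≥0, 0 < C ∧ ∀ (x : X) (r : ℝ), 0 < r →
      Comparable C (μ (Metric.ball x r) ^ e) (ENNReal.ofReal (r ^ (n * e))) := by
  obtain ⟨C, hC, H⟩ := h.exists_comparable hX
  refine ⟨C ^ |e|, NNReal.rpow_pos hC, fun x r hr => ?_⟩
  have := (H x r hr).rpow' hC e
  rwa [ENNReal.ofReal_rpow_of_pos (Real.rpow_pos_of_pos hr n), ← Real.rpow_mul hr.le] at this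

end ADRegular

/-! ### A discrete convolution inequality -/

theorem tsum_pow_natAbs_ne_top {β : ℝ≥0} (hβ : β < 1) :
    ∑' i : ℤ, (β : ℝ≥0∞) ^ i.natAbs ≠ ∞ := by
  have h : Summable fun i : ℤ => β ^ i.natAbs := by
    rw [← NNReal.summable_coe, summable_int_iff_summable_nat_and_neg]
    have := summable_geometric_of_lt_one β.2 (by exact_mod_cast hβ)
    constructor <;> simpa using this
  simpa using ENNReal.tsum_coe_ne_top_iff_summable.2 h

/-- Young's inequality would need P ≥ 1. Instead, split ρ^{|i|} into two factors β^{|i|} with β =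
√ρ: one controls each term by the P-th root of the sum B of all P-th powers, the other makes the
series converge. Summing over k then costs one more geometric series. -/
theorem exists_tsum_convolution_rpow_le {ρ : ℝ≥0} (hρ : ρ < 1) {P : ℝ} (hP : 0 < P) :
    ∃ C : ℝ≥0, ∀ m : ℤ → ℝ≥0∞,
      ∑' k, (∑' j, (ρ : ℝ≥0∞) ^ (j - k).natAbs * m j) ^ P ≤ C * ∑' j, m j ^ P := by
  set β := NNReal.sqrt ρ with hβ
  have hββ : ρ = β * β := (NNReal.mul_self_sqrt ρ).symm
  have hβ1 : β < 1 := by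
    by_contra! h
    exact absurd hρ (not_lt.2 (hββ ▸ one_le_mul h h))
  have hβP : β ^ P < 1 := NNReal.rpow_lt_one hβ1 hP
  set S := ∑' i : ℤ, (β : ℝ≥0∞) ^ i.natAbs with hS
  set S' := ∑' i : ℤ, ((β ^ P : ℝ≥0) : ℝ≥0∞) ^ i.natAbs with hS'
  have hS_top : S ≠ ∞ := tsum_pow_natAbs_ne_top hβ1
  have hS'_top : S' ≠ ∞ := tsum_pow_natAbs_ne_top hβP
  have hC : S ^ P * S' ≠ ∞ := ENNReal.mul_ne_top (ENNReal.rpow_ne_top_of_nonneg hP.le hS_top) hS'_top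
  refine ⟨(S ^ P * S').toNNReal, fun m => ?_⟩
  rw [ENNReal.coe_toNNReal hC]
  have hpow (i : ℤ) : ((β : ℝ≥0∞) ^ i.natAbs) ^ P = ((β ^ P : ℝ≥0) : ℝ≥0∞) ^ i.natAbs := by
    rw [ENNReal.coe_rpow_of_nonneg _ hP.le, ← ENNReal.rpow_natCast, ← ENNReal.rpow_natCast,
      ← ENNReal.rpow_mul, ← ENNReal.rpow_mul, mul_comm]
  have key (k : ℤ) : (∑' j, (ρ : ℝ≥0∞) ^ (j - k).natAbs * m j) ^ P
      ≤ S ^ P * ∑' j, ((β ^ P : ℝ≥0) : ℝ≥0∞) ^ (j - k).natAbs * m j ^ P := by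
    set B := ∑' j, ((β ^ P : ℝ≥0) : ℝ≥0∞) ^ (j - k).natAbs * m j ^ P with hB
    have hterm (j : ℤ) : (β : ℝ≥0∞) ^ (j - k).natAbs * m j ≤ B ^ (1 / P) := by
      rw [one_div, ENNReal.le_rpow_inv_iff hP, ENNReal.mul_rpow_of_nonneg _ _ hP.le, hpow]
      exact ENNReal.le_tsum j
    have hshift : ∑' j : ℤ, (β : ℝ≥0∞) ^ (j - k).natAbs = S :=
      (Equiv.subRight k).tsum_eq fun i : ℤ => (β : ℝ≥0∞) ^ i.natAbs
    calc (∑' j, (ρ : ℝ≥0∞) ^ (j - k).natAbs * m j) ^ P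
        ≤ (∑' j : ℤ, (β : ℝ≥0∞) ^ (j - k).natAbs * B ^ (1 / P)) ^ P := by
          refine ENNReal.rpow_le_rpow (ENNReal.tsum_le_tsum fun j => ?_) hP.le
          rw [hββ, ENNReal.coe_mul, mul_pow, mul_assoc]
          gcongr
          exact hterm j
      _ = S ^ P * B := by
          rw [ENNReal.tsum_mul_right, hshift, ENNReal.mul_rpow_of_nonneg _ _ hP.le,
            ← ENNReal.rpow_mul, one_div_mul_cancel hP.ne', ENNReal.rpow_one]
  calc ∑' k, (∑' j, (ρ : ℝ≥0∞) ^ (j - k).natAbs * m j) ^ P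
      ≤ ∑' k, S ^ P * ∑' j, ((β ^ P : ℝ≥0) : ℝ≥0∞) ^ (j - k).natAbs * m j ^ P :=
        ENNReal.tsum_le_tsum key
    _ = S ^ P * ∑' j, ∑' k, ((β ^ P : ℝ≥0) : ℝ≥0∞) ^ (j - k).natAbs * m j ^ P := by
        rw [ENNReal.tsum_mul_left, ENNReal.tsum_comm]
    _ = S ^ P * ∑' j, S' * m j ^ P := by
        congr 2
        ext j
        rw [ENNReal.tsum_mul_right]
        congr 1
        exact (Equiv.subLeft j).tsum_eq fun i : ℤ => ((β ^ P : ℝ≥0) : ℝ≥0∞) ^ i.natAbs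
    _ = S ^ P * S' * ∑' j, m j ^ P := by rw [ENNReal.tsum_mul_left, mul_assoc]

/-! ### The measure `dt / t` -/

theorem lintegral_dtOverT (h : ℝ → ℝ≥0∞) :
    ∫⁻ t, h t ∂dtOverT = ∫⁻ t in Ioi 0, ENNReal.ofReal t⁻¹ * h t := by
  rw [dtOverT, lintegral_withDensity_eq_lintegral_mul_non_measurable]
  · rfl
  · fun_prop
  · exact Eventually.of_forall fun t => ENNReal.ofReal_lt_top

theorem ae_dtOverT_pos : ∀ᵐ t ∂dtOverT, 0 < t :=
  (withDensity_absolutelyContinuous _ _).ae_le (ae_restrict_mem measurableSet_Ioi)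

theorem ae_dtOverT_ne (c : ℝ) : ∀ᵐ t ∂dtOverT, t ≠ c :=
  ((withDensity_absolutelyContinuous _ _).trans Measure.absolutelyContinuous_restrict).ae_le
    (compl_mem_ae_iff.2 (measure_singleton c))

instance : SigmaFinite dtOverT := by
  unfold dtOverT
  infer_instance

/-- Change of variables α = τ^δ. Negative δ is allowed, so that both orders of s₀ and s₁ are handled
at once. -/
theorem lintegral_dtOverT_comp_rpow {δ : ℝ} (hδ : δ ≠ 0) (h : ℝ → ℝ≥0∞) :
    ∫⁻ α, h α ∂dtOverT = ENNReal.ofReal |δ| * ∫⁻ τ, h (τ ^ δ) ∂dtOverT := by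
  have himage : (fun τ : ℝ => τ ^ δ) '' Ioi 0 = Ioi 0 := by
    ext α
    constructor
    · rintro ⟨τ, hτ, rfl⟩
      exact Real.rpow_pos_of_pos hτ δ
    · intro hα
      exact ⟨α ^ δ⁻¹, Real.rpow_pos_of_pos hα _, Real.rpow_inv_rpow (le_of_lt hα) hδ⟩
  have hinj : InjOn (fun τ : ℝ => τ ^ δ) (Ioi 0) := fun a ha b hb hab => by
    rw [← Real.rpow_rpow_inv (le_of_lt ha) hδ, ← Real.rpow_rpow_inv (le_of_lt hb) hδ]
    exact congrArg (· ^ δ⁻¹) hab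
  rw [lintegral_dtOverT, lintegral_dtOverT, ← lintegral_const_mul' _ _ ENNReal.ofReal_ne_top]
  conv_lhs => rw [← himage]
  rw [lintegral_image_eq_lintegral_abs_deriv_mul measurableSet_Ioi
    (fun τ hτ => (Real.hasDerivAt_rpow_const (Or.inl (ne_of_gt hτ))).hasDerivWithinAt) hinj]
  refine setLIntegral_congr_fun measurableSet_Ioi fun τ hτ => ?_
  have hτ : 0 < τ := hτ
  rw [← mul_assoc, ← mul_assoc, ← ENNReal.ofReal_mul (abs_nonneg _),
    ← ENNReal.ofReal_mul (abs_nonneg _), abs_mul, abs_of_pos (Real.rpow_pos_of_pos hτ _),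
    Real.rpow_sub_one hτ.ne']
  congr 2
  have := (Real.rpow_pos_of_pos hτ δ).ne'
  field_simp

/-- The exact mass is log r; bounds uniform in k are all that is needed. -/
theorem dtOverT_Ico {r : ℝ} (hr : 1 < r) (k : ℤ) :
    ENNReal.ofReal ((r - 1) / r) ≤ dtOverT (Ico (r ^ k) (r ^ (k + 1))) ∧
      dtOverT (Ico (r ^ k) (r ^ (k + 1))) ≤ ENNReal.ofReal (r - 1) := by
  have hr0 : 0 < r := by linarith
  have hk : 0 < r ^ k := zpow_pos hr0 k
  have hk1 : r ^ (k + 1) = r ^ k * r := zpow_add_one₀ hr0.ne' k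
  have hvol : volume (Ico (r ^ k) (r ^ (k + 1))) = ENNReal.ofReal (r ^ k * (r - 1)) := by
    rw [Real.volume_Ico, hk1]
    congr 1
    ring
  have hsub : Ico (r ^ k) (r ^ (k + 1)) ⊆ Ioi 0 := fun t ht => hk.trans_le ht.1
  have hrep : dtOverT (Ico (r ^ k) (r ^ (k + 1)))
      = ∫⁻ t in Ico (r ^ k) (r ^ (k + 1)), ENNReal.ofReal t⁻¹ := by
    rw [dtOverT, withDensity_apply _ measurableSet_Ico, Measure.restrict_restrict_of_subset hsub]
  rw [hrep]
  constructor
  · calc ENNReal.ofReal ((r - 1) / r)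
        = ∫⁻ t in Ico (r ^ k) (r ^ (k + 1)), ENNReal.ofReal (r ^ k * r)⁻¹ := by
          rw [setLIntegral_const, hvol, ← ENNReal.ofReal_mul (by positivity)]
          congr 1
          field_simp
      _ ≤ _ := by
          refine setLIntegral_mono' measurableSet_Ico fun t ht => ENNReal.ofReal_le_ofReal ?_
          exact inv_anti₀ (hk.trans_le ht.1) (hk1 ▸ ht.2.le)
  · calc ∫⁻ t in Ico (r ^ k) (r ^ (k + 1)), ENNReal.ofReal t⁻¹
        ≤ ∫⁻ t in Ico (r ^ k) (r ^ (k + 1)), ENNReal.ofReal (r ^ k)⁻¹ := by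
          refine setLIntegral_mono' measurableSet_Ico fun t ht => ENNReal.ofReal_le_ofReal ?_
          exact inv_anti₀ hk ht.1
      _ = _ := by
          rw [setLIntegral_const, hvol, ← ENNReal.ofReal_mul (by positivity)]
          congr 1
          field_simp

theorem pairwise_disjoint_Ico_zpow {r : ℝ} (hr : 1 < r) :
    Pairwise (Function.onFun Disjoint fun k : ℤ => Ico (r ^ k) (r ^ (k + 1))) :=
  (zpow_right_mono₀ hr.le).pairwise_disjoint_on_Ico_succ

/-! ### Dyadic discretization of dilation-invariant averages -/

section Layers

variable {Z : Type*} [MeasurableSpace Z] {T : Z → ℝ} {r P : ℝ}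

/-- The kernel `φ(T(z) / τ)` decays geometrically in the distance between the layer of `z` and the
layer of `τ`. -/
theorem exists_kernel_le_pow_natAbs {φ : ℝ → ℝ≥0∞} {c d : ℝ} (hr : 1 < r) (hc : 0 < c) (hd : 0 < d)
    (hφc : ∀ u, 0 < u → φ u ≤ ENNReal.ofReal (u ^ c))
    (hφd : ∀ u, 0 < u → φ u ≤ ENNReal.ofReal (u ^ (-d))) :
    ∃ D ρ : ℝ≥0, ρ < 1 ∧ ∀ (i : ℤ) (u : ℝ), r ^ (i - 2) < u → u < r ^ i →
      φ u ≤ D * (ρ : ℝ≥0∞) ^ i.natAbs := by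
  have hr0 : 0 < r := by linarith
  set ε := min c d with hε
  have hε0 : 0 < ε := lt_min hc hd
  -- The slower of the two decay rates gives the ratio. The factor r^{2d} pays for the left endpoint
  -- r^{i-2} when u^{-d} is estimated at i ≥ 0.
  refine ⟨(r ^ (2 * d)).toNNReal, (r ^ (-ε)).toNNReal, ?_, fun i u hu₁ hu₂ => ?_⟩
  · rw [Real.toNNReal_lt_one]
    exact Real.rpow_lt_one_of_one_lt_of_neg hr (by linarith)
  have hu : 0 < u := (zpow_pos hr0 _).trans hu₁
  change φ u ≤ ENNReal.ofReal _ * ENNReal.ofReal _ ^ _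
  rw [← ENNReal.ofReal_pow (by positivity), ← ENNReal.ofReal_mul (by positivity),
    ← Real.rpow_natCast (r ^ (-ε)), ← Real.rpow_mul hr0.le, ← Real.rpow_add hr0]
  rcases le_total 0 i with hi | hi
  · refine (hφd u hu).trans (ENNReal.ofReal_le_ofReal ?_)
    have hcast : ((i.natAbs : ℕ) : ℝ) = i := by
      rw [← Int.cast_natCast, Int.natCast_natAbs, abs_of_nonneg hi]
    have hi' : (0 : ℝ) ≤ i := by exact_mod_cast hi
    calc u ^ (-d) ≤ (r ^ (i - 2)) ^ (-d) :=
          Real.rpow_le_rpow_of_nonpos (zpow_pos hr0 _) hu₁.le (by linarith)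
      _ = r ^ (((i - 2 : ℤ) : ℝ) * (-d)) := by rw [← Real.rpow_intCast, ← Real.rpow_mul hr0.le]
      _ ≤ _ := by
          refine Real.rpow_le_rpow_of_exponent_le hr.le ?_
          rw [hcast]
          push_cast
          nlinarith [min_le_right c d]
  · refine (hφc u hu).trans (ENNReal.ofReal_le_ofReal ?_)
    have hcast : ((i.natAbs : ℕ) : ℝ) = -i := by
      rw [← Int.cast_natCast, Int.natCast_natAbs, abs_of_nonpos hi]
      push_cast
      rfl
    have hi' : (i : ℝ) ≤ 0 := by exact_mod_cast hi
    calc u ^ c ≤ (r ^ i) ^ c := Real.rpow_le_rpow hu.le hu₂.le hc.le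
      _ = r ^ ((i : ℝ) * c) := by rw [← Real.rpow_intCast, ← Real.rpow_mul hr0.le]
      _ ≤ _ := by
          refine Real.rpow_le_rpow_of_exponent_le hr.le ?_
          rw [hcast]
          nlinarith [min_le_left c d]

/-- For τ in layer k and z in layer j the kernel is at most a constant times ρ^{|j-k|}, so the inner
integral is dominated by a discrete convolution of the layer masses. The layers are open, hence
cover only if the values r^k are avoided almost everywhere. The constant does not depend on ν, which
later makes it uniform over all cones. -/
theorem exists_lintegral_kernel_le_tsum_layers {φ : ℝ → ℝ≥0∞} {c d : ℝ} (hT : Measurable T)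
    (hr : 1 < r) (hP : 0 < P) (hc : 0 < c) (hd : 0 < d)
    (hφc : ∀ u, 0 < u → φ u ≤ ENNReal.ofReal (u ^ c))
    (hφd : ∀ u, 0 < u → φ u ≤ ENNReal.ofReal (u ^ (-d))) :
    ∃ C : ℝ≥0, ∀ (ν : Measure Z) (w : Z → ℝ≥0∞),
      (∀ᵐ z ∂ν, 0 < T z ∧ ∀ k : ℤ, T z ≠ r ^ k) →
      ∫⁻ τ, (∫⁻ z, φ (T z / τ) * w z ∂ν) ^ P ∂dtOverT
        ≤ C * ∑' k : ℤ, (∫⁻ z in T ⁻¹' Ioo (r ^ (k - 1)) (r ^ k), w z ∂ν) ^ P := by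
  have hr0 : 0 < r := by linarith
  obtain ⟨D, ρ, hρ, hφ⟩ := exists_kernel_le_pow_natAbs hr hc hd hφc hφd
  obtain ⟨C, hC⟩ := exists_tsum_convolution_rpow_le hρ hP
  refine ⟨(r - 1).toNNReal * D ^ P * C, fun ν w hν => ?_⟩
  set m : ℤ → ℝ≥0∞ := fun k => ∫⁻ z in T ⁻¹' Ioo (r ^ (k - 1)) (r ^ k), w z ∂ν with hm
  have hinner (k : ℤ) (τ : ℝ) (hτ : τ ∈ Ico (r ^ k) (r ^ (k + 1))) :
      ∫⁻ z, φ (T z / τ) * w z ∂ν ≤ D * ∑' j, (ρ : ℝ≥0∞) ^ (j - k).natAbs * m j := by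
    have hτ0 : 0 < τ := (zpow_pos hr0 k).trans_le hτ.1
    have hcover : ∀ᵐ z ∂ν, z ∈ ⋃ j : ℤ, T ⁻¹' Ioo (r ^ (j - 1)) (r ^ j) := by
      filter_upwards [hν] with z hz
      obtain ⟨j, hj⟩ := exists_mem_Ico_zpow hz.1 hr
      refine mem_iUnion.2 ⟨j + 1, ?_, hj.2⟩
      rw [add_sub_cancel_right]
      exact lt_of_le_of_ne hj.1 (hz.2 j).symm
    calc ∫⁻ z, φ (T z / τ) * w z ∂ν
        = ∫⁻ z in ⋃ j : ℤ, T ⁻¹' Ioo (r ^ (j - 1)) (r ^ j), φ (T z / τ) * w z ∂ν := by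
          rw [Measure.restrict_eq_self_of_ae_mem hcover]
      _ ≤ ∑' j : ℤ, ∫⁻ z in T ⁻¹' Ioo (r ^ (j - 1)) (r ^ j), φ (T z / τ) * w z ∂ν :=
          lintegral_iUnion_le _ _
      _ ≤ ∑' j : ℤ, D * ((ρ : ℝ≥0∞) ^ (j - k).natAbs * m j) := by
          refine ENNReal.tsum_le_tsum fun j => ?_
          rw [← mul_assoc, hm, ← lintegral_const_mul' _ _
            (ENNReal.mul_ne_top ENNReal.coe_ne_top (ENNReal.pow_ne_top ENNReal.coe_ne_top))]
          refine setLIntegral_mono' (hT measurableSet_Ioo) fun z hz => ?_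
          gcongr
          -- The quotient of a point of (r^{j-1}, r^j) by one of [r^k, r^{k+1}) lies in (r^{j-k-2},
          -- r^{j-k}).
          refine hφ _ _ ?_ ?_
          · rw [lt_div_iff₀ hτ0]
            calc r ^ (j - k - 2) * τ < r ^ (j - k - 2) * r ^ (k + 1) := by
                  have := zpow_pos hr0 (j - k - 2)
                  gcongr
                  exact hτ.2
              _ = r ^ (j - 1) := by rw [← zpow_add₀ hr0.ne']; congr 1; ring
              _ < T z := hz.1
          · rw [div_lt_iff₀ hτ0]
            calc T z < r ^ j := hz.2
              _ = r ^ (j - k) * r ^ k := by rw [← zpow_add₀ hr0.ne']; congr 1; ring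
              _ ≤ r ^ (j - k) * τ := by
                  have := zpow_pos hr0 (j - k)
                  gcongr
                  exact hτ.1
      _ = _ := ENNReal.tsum_mul_left
  have hcover : ∀ᵐ τ ∂dtOverT, τ ∈ ⋃ k : ℤ, Ico (r ^ k) (r ^ (k + 1)) := by
    filter_upwards [ae_dtOverT_pos] with τ hτ
    exact mem_iUnion.2 (exists_mem_Ico_zpow hτ hr)
  calc ∫⁻ τ, (∫⁻ z, φ (T z / τ) * w z ∂ν) ^ P ∂dtOverT
      = ∫⁻ τ in ⋃ k : ℤ, Ico (r ^ k) (r ^ (k + 1)),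
          (∫⁻ z, φ (T z / τ) * w z ∂ν) ^ P ∂dtOverT := by
        rw [Measure.restrict_eq_self_of_ae_mem hcover]
    _ ≤ ∑' k : ℤ, ∫⁻ τ in Ico (r ^ k) (r ^ (k + 1)),
          (∫⁻ z, φ (T z / τ) * w z ∂ν) ^ P ∂dtOverT := lintegral_iUnion_le _ _
    _ ≤ ∑' k : ℤ, ENNReal.ofReal (r - 1) * (D : ℝ≥0∞) ^ P *
          (∑' j, (ρ : ℝ≥0∞) ^ (j - k).natAbs * m j) ^ P := by
        refine ENNReal.tsum_le_tsum fun k => ?_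
        calc _ ≤ ∫⁻ τ in Ico (r ^ k) (r ^ (k + 1)),
              (D * ∑' j, (ρ : ℝ≥0∞) ^ (j - k).natAbs * m j) ^ P ∂dtOverT :=
              setLIntegral_mono' measurableSet_Ico fun τ hτ =>
                ENNReal.rpow_le_rpow (hinner k τ hτ) hP.le
          _ ≤ _ := by
              rw [setLIntegral_const, ENNReal.mul_rpow_of_nonneg _ _ hP.le, mul_comm, mul_assoc]
              gcongr
              exact (dtOverT_Ico hr k).2
    _ = ENNReal.ofReal (r - 1) * (D : ℝ≥0∞) ^ P *
          ∑' k : ℤ, (∑' j, (ρ : ℝ≥0∞) ^ (j - k).natAbs * m j) ^ P := ENNReal.tsum_mul_left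
    _ ≤ ENNReal.ofReal (r - 1) * (D : ℝ≥0∞) ^ P * (C * ∑' k, m k ^ P) := by
        gcongr
        exact hC m
    _ = _ := by
        rw [ENNReal.coe_mul, ENNReal.coe_mul, ENNReal.coe_rpow_of_nonneg _ hP.le, mul_assoc _ (C : ℝ≥0∞)]
        rfl

theorem exists_tsum_layers_le_lintegral_kernel {φ : ℝ → ℝ≥0∞} {η : ℝ≥0} (hT : Measurable T)
    (hr : 1 < r) (hP : 0 < P) (hη : 0 < η) (i : ℤ)
    (hφ : ∀ u, r ^ (i - 1) < u → u < r ^ (i + 1) → η ≤ φ u) :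
    ∃ C : ℝ≥0, ∀ (ν : Measure Z) (w : Z → ℝ≥0∞),
      ∑' k : ℤ, (∫⁻ z in T ⁻¹' Ioo (r ^ (k - 1)) (r ^ k), w z ∂ν) ^ P
        ≤ C * ∫⁻ τ, (∫⁻ z, φ (T z / τ) * w z ∂ν) ^ P ∂dtOverT := by
  have hr0 : 0 < r := by linarith
  have hr1 : 0 < (r - 1) / r := div_pos (by linarith) hr0
  set a : ℝ≥0 := ((r - 1) / r).toNNReal * η ^ P with ha
  have ha0 : 0 < a := mul_pos (Real.toNNReal_pos.2 hr1) (NNReal.rpow_pos hη)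
  refine ⟨a⁻¹, fun ν w => ?_⟩
  set m : ℤ → ℝ≥0∞ := fun k => ∫⁻ z in T ⁻¹' Ioo (r ^ (k - 1)) (r ^ k), w z ∂ν with hm
  set F : ℝ → ℝ≥0∞ := fun τ => (∫⁻ z, φ (T z / τ) * w z ∂ν) ^ P with hF
  -- For z in layer k, this window of τ forces T z / τ into (r^{i-1}, r^{i+1}), where the kernel is
  -- at least η. Distinct k give disjoint windows, so their contributions add up.
  have hinner (k : ℤ) (τ : ℝ) (hτ : τ ∈ Ico (r ^ (k - i - 1)) (r ^ (k - i - 1 + 1))) :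
      (η : ℝ≥0∞) ^ P * m k ^ P ≤ F τ := by
    have hτ0 : 0 < τ := (zpow_pos hr0 _).trans_le hτ.1
    rw [← ENNReal.mul_rpow_of_nonneg _ _ hP.le]
    refine ENNReal.rpow_le_rpow ?_ hP.le
    rw [hm, ← lintegral_const_mul' _ _ ENNReal.coe_ne_top]
    refine le_trans (setLIntegral_mono' (hT measurableSet_Ioo) fun z hz => ?_)
      (setLIntegral_le_lintegral (T ⁻¹' Ioo (r ^ (k - 1)) (r ^ k)) _)
    gcongr
    refine hφ _ ?_ ?_
    · rw [lt_div_iff₀ hτ0]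
      calc r ^ (i - 1) * τ < r ^ (i - 1) * r ^ (k - i - 1 + 1) := by
            have := zpow_pos hr0 (i - 1)
            gcongr
            exact hτ.2
        _ = r ^ (k - 1) := by rw [← zpow_add₀ hr0.ne']; congr 1; ring
        _ < T z := hz.1
    · rw [div_lt_iff₀ hτ0]
      calc T z < r ^ k := hz.2
        _ = r ^ (i + 1) * r ^ (k - i - 1) := by rw [← zpow_add₀ hr0.ne']; congr 1; ring
        _ ≤ r ^ (i + 1) * τ := by
            have := zpow_pos hr0 (i + 1)
            gcongr
            exact hτ.1
  have hmain : (a : ℝ≥0∞) * ∑' k, m k ^ P ≤ ∫⁻ τ, F τ ∂dtOverT := by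
    calc (a : ℝ≥0∞) * ∑' k, m k ^ P
        = ∑' k, ENNReal.ofReal ((r - 1) / r) * ((η : ℝ≥0∞) ^ P * m k ^ P) := by
          rw [← ENNReal.tsum_mul_left]
          congr 1
          ext k
          rw [ha, ENNReal.coe_mul, ENNReal.coe_rpow_of_nonneg _ hP.le, mul_assoc]
          rfl
      _ ≤ ∑' k : ℤ, ∫⁻ τ in Ico (r ^ (k - i - 1)) (r ^ (k - i - 1 + 1)), F τ ∂dtOverT := by
          refine ENNReal.tsum_le_tsum fun k => ?_
          calc _ ≤ ∫⁻ τ in Ico (r ^ (k - i - 1)) (r ^ (k - i - 1 + 1)),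
                (η : ℝ≥0∞) ^ P * m k ^ P ∂dtOverT := by
                rw [setLIntegral_const, mul_comm]
                gcongr
                exact (dtOverT_Ico hr _).1
            _ ≤ _ := setLIntegral_mono' measurableSet_Ico fun τ hτ => hinner k τ hτ
      _ = ∑' k : ℤ, ∫⁻ τ in Ico (r ^ k) (r ^ (k + 1)), F τ ∂dtOverT := by
          simp_rw [sub_sub]
          exact (Equiv.subRight (i + 1)).tsum_eq fun k : ℤ =>
            ∫⁻ τ in Ico (r ^ k) (r ^ (k + 1)), F τ ∂dtOverT
      _ = ∫⁻ τ in ⋃ k : ℤ, Ico (r ^ k) (r ^ (k + 1)), F τ ∂dtOverT :=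
          (lintegral_iUnion (fun _ => measurableSet_Ico) (pairwise_disjoint_Ico_zpow hr) _).symm
      _ ≤ _ := setLIntegral_le_lintegral _ _
  rw [ENNReal.coe_inv ha0.ne']
  exact (ENNReal.mul_le_iff_le_inv (by exact_mod_cast ha0.ne') ENNReal.coe_ne_top).1 hmain

/-- An average over dilations of a kernel that decays at `0` and at `∞` and is bounded below on
some layer is comparable to the sum over all layers. -/
theorem exists_comparable_lintegral_kernel_tsum_layers {φ : ℝ → ℝ≥0∞} {c d : ℝ} {η : ℝ≥0}
    (hT : Measurable T) (hr : 1 < r) (hP : 0 < P) (hc : 0 < c) (hd : 0 < d)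
    (hφc : ∀ u, 0 < u → φ u ≤ ENNReal.ofReal (u ^ c))
    (hφd : ∀ u, 0 < u → φ u ≤ ENNReal.ofReal (u ^ (-d))) (hη : 0 < η) (i : ℤ)
    (hφ : ∀ u, r ^ (i - 1) < u → u < r ^ (i + 1) → η ≤ φ u) :
    ∃ C : ℝ≥0, ∀ (ν : Measure Z) (w : Z → ℝ≥0∞),
      (∀ᵐ z ∂ν, 0 < T z ∧ ∀ k : ℤ, T z ≠ r ^ k) →
      Comparable C (∫⁻ τ, (∫⁻ z, φ (T z / τ) * w z ∂ν) ^ P ∂dtOverT)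
        (∑' k : ℤ, (∫⁻ z in T ⁻¹' Ioo (r ^ (k - 1)) (r ^ k), w z ∂ν) ^ P) := by
  obtain ⟨C, hC⟩ := exists_lintegral_kernel_le_tsum_layers hT hr hP hc hd hφc hφd
  obtain ⟨D, hD⟩ := exists_tsum_layers_le_lintegral_kernel hT hr hP hη i hφ
  refine ⟨max C D, fun ν w hν => ⟨(hC ν w hν).trans ?_, (hD ν w).trans ?_⟩⟩
  · gcongr
    exact le_max_left _ _
  · gcongr
    exact le_max_right _ _

end Layers

/-! ### The `K`-functional of a couple of weighted `L^q` spaces -/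

theorem add_rpow_le_two_rpow_mul (a b : ℝ≥0∞) {q : ℝ} (hq : 0 ≤ q) :
    (a + b) ^ q ≤ 2 ^ q * (a ^ q + b ^ q) := by
  have h : a + b ≤ 2 * max a b := by
    rw [two_mul]
    exact add_le_add (le_max_left _ _) (le_max_right _ _)
  calc (a + b) ^ q ≤ (2 * max a b) ^ q := ENNReal.rpow_le_rpow h hq
    _ = 2 ^ q * max a b ^ q := ENNReal.mul_rpow_of_nonneg _ _ hq
    _ ≤ 2 ^ q * (a ^ q + b ^ q) := by
        gcongr
        rcases max_choice a b with h | h <;> rw [h]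
        · exact le_self_add
        · exact le_add_self

/-- Assigning each point to the smaller weight gives a near-optimal decomposition. Conversely, in
any decomposition |g|^q ≤ 2^q(|φ₀|^q + |φ₁|^q), and the minimum is below each weight. No triangle
inequality in L^q is used, so q < 1 is allowed. -/
theorem comparable_kFunctional {Z : Type*} [MeasurableSpace Z] (ν : Measure Z)
    {W₀ W₁ : Z → ℝ≥0∞} (hW₀ : Measurable W₀) (hW₁ : Measurable W₁) {q α : ℝ} (hq : 0 < q)
    (hα : 0 < α) {g : Z → ℂ} (hg : AEStronglyMeasurable g ν) :
    Comparable (2 * 2 ^ (1 / q))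
      (kFunctional ν (fun φ => (∫⁻ z, ‖φ z‖ₑ ^ q * W₀ z ∂ν) ^ (1 / q))
        (fun φ => (∫⁻ z, ‖φ z‖ₑ ^ q * W₁ z ∂ν) ^ (1 / q)) α g)
      ((∫⁻ z, ‖g z‖ₑ ^ q * min (W₀ z) (ENNReal.ofReal (α ^ q) * W₁ z) ∂ν) ^ (1 / q)) := by
  have hq' : 0 ≤ 1 / q := by positivity
  have hcoe : ((2 * 2 ^ (1 / q) : ℝ≥0) : ℝ≥0∞) = 2 * 2 ^ (1 / q) := by
    rw [ENNReal.coe_mul, ENNReal.coe_rpow_of_nonneg _ hq']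
    rfl
  have hroot (a : ℝ≥0∞) : (a ^ (1 / q)) ^ q = a := by
    rw [← ENNReal.rpow_mul, one_div_mul_cancel hq.ne', ENNReal.rpow_one]
  have hroot' (a : ℝ≥0∞) : (a ^ q) ^ (1 / q) = a := by
    rw [← ENNReal.rpow_mul, mul_one_div_cancel hq.ne', ENNReal.rpow_one]
  have hαq : ENNReal.ofReal (α ^ q) = ENNReal.ofReal α ^ q :=
    (ENNReal.ofReal_rpow_of_pos hα).symm
  set m : Z → ℝ≥0∞ := fun z => min (W₀ z) (ENNReal.ofReal (α ^ q) * W₁ z) with hm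
  have hm_meas : Measurable m := hW₀.min (hW₁.const_mul _)
  have hscale (φ : Z → ℂ) : ENNReal.ofReal α * (∫⁻ z, ‖φ z‖ₑ ^ q * W₁ z ∂ν) ^ (1 / q)
      = (∫⁻ z, ‖φ z‖ₑ ^ q * (ENNReal.ofReal (α ^ q) * W₁ z) ∂ν) ^ (1 / q) := by
    simp_rw [mul_left_comm _ (ENNReal.ofReal (α ^ q))]
    rw [lintegral_const_mul' _ _ ENNReal.ofReal_ne_top, ENNReal.mul_rpow_of_nonneg _ _ hq', hαq,
      hroot']
  unfold Comparable
  rw [hcoe]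
  constructor
  · set E : Set Z := {z | W₀ z ≤ ENNReal.ofReal (α ^ q) * W₁ z} with hE
    have hE_meas : MeasurableSet E := measurableSet_le hW₀ (hW₁.const_mul _)
    have hsum : g =ᵐ[ν] E.indicator g + Eᶜ.indicator g := by
      rw [indicator_self_add_compl]
    unfold kFunctional
    refine (iInf_le _ (E.indicator g)).trans <| (iInf_le _ (Eᶜ.indicator g)).trans <|
      (iInf_le _ (hg.indicator hE_meas)).trans <| (iInf_le _ (hg.indicator hE_meas.compl)).trans <|
      (iInf_le _ hsum).trans ?_
    have h₀ : (∫⁻ z, ‖E.indicator g z‖ₑ ^ q * W₀ z ∂ν) ^ (1 / q)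
        ≤ (∫⁻ z, ‖g z‖ₑ ^ q * m z ∂ν) ^ (1 / q) := by
      refine ENNReal.rpow_le_rpow (lintegral_mono fun z => ?_) hq'
      by_cases hz : z ∈ E
      · have : m z = W₀ z := min_eq_left hz
        simp [hz, this]
      · simp [hz, hq]
    have h₁ : (∫⁻ z, ‖Eᶜ.indicator g z‖ₑ ^ q * (ENNReal.ofReal (α ^ q) * W₁ z) ∂ν) ^ (1 / q)
        ≤ (∫⁻ z, ‖g z‖ₑ ^ q * m z ∂ν) ^ (1 / q) := by
      refine ENNReal.rpow_le_rpow (lintegral_mono fun z => ?_) hq'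
      by_cases hz : z ∈ E
      · simp [hz, hq]
      · have : m z = ENNReal.ofReal (α ^ q) * W₁ z := min_eq_right (le_of_lt (not_le.1 hz))
        simp [hz, this]
    rw [hscale]
    calc _ ≤ 2 * (∫⁻ z, ‖g z‖ₑ ^ q * m z ∂ν) ^ (1 / q) := by
          rw [two_mul]
          exact add_le_add h₀ h₁
      _ ≤ _ := by
          gcongr
          calc (2 : ℝ≥0∞) = 2 * 1 := (mul_one 2).symm
            _ ≤ 2 * 2 ^ (1 / q) := by
                gcongr
                exact ENNReal.one_le_rpow (by norm_num) (by positivity)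
  · have hC : (2 * 2 ^ (1 / q) : ℝ≥0∞) ≠ ∞ :=
      ENNReal.mul_ne_top (by norm_num) (ENNReal.rpow_ne_top_of_nonneg hq' (by norm_num))
    have hC0 : (2 * 2 ^ (1 / q) : ℝ≥0∞) ≠ 0 := by simp
    -- Moving the constant to the left leaves the bare infimum on the right, to be bounded below one
    -- decomposition at a time.
    rw [← ENNReal.inv_mul_le_iff hC0 hC]
    refine le_iInf fun φ₀ => le_iInf fun φ₁ => le_iInf fun hφ₀ => le_iInf fun hφ₁ =>
      le_iInf fun hsum => ?_
    rw [ENNReal.inv_mul_le_iff hC0 hC, hscale]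
    set A := (∫⁻ z, ‖φ₀ z‖ₑ ^ q * W₀ z ∂ν) ^ (1 / q) with hA
    set B := (∫⁻ z, ‖φ₁ z‖ₑ ^ q * (ENNReal.ofReal (α ^ q) * W₁ z) ∂ν) ^ (1 / q) with hB
    have hmeas : AEMeasurable (fun z => ‖φ₀ z‖ₑ ^ q * m z) ν :=
      (hφ₀.enorm.pow_const q).mul hm_meas.aemeasurable
    have key : ∫⁻ z, ‖g z‖ₑ ^ q * m z ∂ν ≤ 2 ^ q * (2 * (A + B) ^ q) := by
      calc ∫⁻ z, ‖g z‖ₑ ^ q * m z ∂ν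
          ≤ ∫⁻ z, 2 ^ q * (‖φ₀ z‖ₑ ^ q * m z + ‖φ₁ z‖ₑ ^ q * m z) ∂ν := by
            refine lintegral_mono_ae (hsum.mono fun z hz => ?_)
            rw [hz, ← add_mul, ← mul_assoc]
            gcongr
            exact (ENNReal.rpow_le_rpow (enorm_add_le _ _) hq.le).trans
              (add_rpow_le_two_rpow_mul _ _ hq.le)
        _ = 2 ^ q * (∫⁻ z, ‖φ₀ z‖ₑ ^ q * m z ∂ν + ∫⁻ z, ‖φ₁ z‖ₑ ^ q * m z ∂ν) := by
            rw [lintegral_const_mul' _ _ (ENNReal.rpow_ne_top_of_nonneg hq.le (by norm_num)),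
              lintegral_add_left' hmeas]
        _ ≤ 2 ^ q * (A ^ q + B ^ q) := by
            rw [hA, hB, hroot, hroot]
            gcongr
            · exact min_le_left _ _
            · exact min_le_right _ _
        -- Each of A^q and B^q is at most (A + B)^q; this 2 becomes the factor 2^{1/q} after taking
        -- the root.
        _ ≤ 2 ^ q * (2 * (A + B) ^ q) := by
            rw [two_mul]
            gcongr
            · exact le_self_add
            · exact le_add_self
    calc (∫⁻ z, ‖g z‖ₑ ^ q * m z ∂ν) ^ (1 / q)
        ≤ (2 ^ q * (2 * (A + B) ^ q)) ^ (1 / q) := ENNReal.rpow_le_rpow key hq'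
      _ = 2 * 2 ^ (1 / q) * (A + B) := by
          rw [ENNReal.mul_rpow_of_nonneg _ _ hq', ENNReal.mul_rpow_of_nonneg _ _ hq', hroot', hroot',
            mul_assoc]

/-! ### Measurability of cones and volumes -/

section Measurability

variable {X : Type*} [MetricSpace X] [MeasurableSpace X] [BorelSpace X]
  [SecondCountableTopology X]

theorem measurableSet_setOf_mem_cone : MeasurableSet {a : X × (X × ℝ) | a.2 ∈ cone a.1} := by
  have h₁ : MeasurableSet {a : X × (X × ℝ) | 0 < a.2.2} :=
    measurableSet_lt measurable_const (by fun_prop)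
  have h₂ : MeasurableSet {a : X × (X × ℝ) | dist a.2.1 a.1 < a.2.2} :=
    measurableSet_lt (by fun_prop) (by fun_prop)
  exact h₁.inter h₂

theorem measurableSet_cone (x : X) : MeasurableSet (cone x) :=
  measurable_prodMk_left measurableSet_setOf_mem_cone

theorem measurable_measure_ball (μ : Measure X) [SFinite μ] :
    Measurable fun z : X × ℝ => μ (Metric.ball z.1 z.2) := by
  have h : MeasurableSet {a : (X × ℝ) × X | dist a.2 a.1.1 < a.1.2} :=
    measurableSet_lt (by fun_prop) (by fun_prop)
  exact measurable_measure_prodMk_left h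

end Measurability

theorem ae_halfSpace_snd {X : Type*} [MeasurableSpace X] (μ : Measure X) [SFinite μ]
    {Q : ℝ → Prop} (h : ∀ᵐ t ∂dtOverT, Q t) : ∀ᵐ z ∂halfSpace μ, Q z.2 :=
  Measure.quasiMeasurePreserving_snd.ae h

/-! ### The common discrete quasi-norm -/

section DiscreteNorm

variable {X : Type*} [MetricSpace X] [MeasurableSpace X]

/-- The weighted density `|f(y, t)|^q t^{-n(σq+1)}`. -/
def weightedDensity (n q σ : ℝ) (f : X × ℝ → ℂ) (z : X × ℝ) : ℝ≥0∞ :=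
  ‖f z‖ₑ ^ q * ENNReal.ofReal (z.2 ^ (-(n * (σ * q + 1))))

/-- The discretized quasi-norm to which all the quasi-norms under consideration are compared. -/
def discreteNorm (μ : Measure X) (n p q σ r : ℝ) (f : X × ℝ → ℂ) : ℝ≥0∞ :=
  (∫⁻ x, ∑' k : ℤ, (∫⁻ z in Prod.snd ⁻¹' Ioo (r ^ (k - 1)) (r ^ k), weightedDensity n q σ f z
    ∂((halfSpace μ).restrict (cone x))) ^ (p / q) ∂μ) ^ (1 / p)

theorem MemL0.aemeasurable_weightedDensity {X : Type*} [MeasurableSpace X] {μ : Measure X}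
    {n q σ : ℝ} {f : X × ℝ → ℂ} (hf : MemL0 μ f) :
    AEMeasurable (weightedDensity n q σ f) (halfSpace μ) :=
  (hf.enorm.pow_const q).mul (by fun_prop)

/-- The layer comparison is applied to the half-space measure restricted to each cone. Its constant
is the same for all measures, so the result integrates in x. -/
theorem exists_comparable_kernel_discreteNorm {φ : ℝ → ℝ≥0∞} {c d p q r : ℝ} {η : ℝ≥0}
    (μ : Measure X) [SigmaFinite μ] (n σ : ℝ) (hr : 1 < r) (hp : 0 < p) (hq : 0 < q)
    (hc : 0 < c) (hd : 0 < d) (hφc : ∀ u, 0 < u → φ u ≤ ENNReal.ofReal (u ^ c))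
    (hφd : ∀ u, 0 < u → φ u ≤ ENNReal.ofReal (u ^ (-d))) (hη : 0 < η) (i : ℤ)
    (hφ : ∀ u, r ^ (i - 1) < u → u < r ^ (i + 1) → η ≤ φ u) :
    ∃ C : ℝ≥0, ∀ f : X × ℝ → ℂ, Comparable C
      ((∫⁻ x, ∫⁻ τ, (∫⁻ z in cone x, φ (z.2 / τ) * weightedDensity n q σ f z ∂halfSpace μ) ^ (p / q)
        ∂dtOverT ∂μ) ^ (1 / p))
      (discreteNorm μ n p q σ r f) := by
  obtain ⟨C, hC⟩ := exists_comparable_lintegral_kernel_tsum_layers (Z := X × ℝ) measurable_snd hr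
    (div_pos hp hq) hc hd hφc hφd hη i hφ
  refine ⟨C ^ (1 / p), fun f => Comparable.rpow (Comparable.lintegral (Eventually.of_forall
    fun x => hC _ _ (ae_restrict_of_ae ?_))) (by positivity)⟩
  refine ae_halfSpace_snd (Q := fun t => 0 < t ∧ ∀ k : ℤ, t ≠ r ^ k) μ ?_
  exact ae_dtOverT_pos.and (ae_all_iff.2 fun k => ae_dtOverT_ne _)

variable [BorelSpace X] [SecondCountableTopology X] {μ : Measure X} [SigmaFinite μ]
  {n p q σ r : ℝ} {f : X × ℝ → ℂ}

instance : SFinite (halfSpace μ) := by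
  unfold halfSpace
  infer_instance

theorem measurable_lintegral_cone {Y : Type*} [MeasurableSpace Y] {g : Y → X × ℝ → ℝ≥0∞}
    (hg : Measurable (Function.uncurry g)) :
    Measurable fun a : Y × X => ∫⁻ z in cone a.2, g a.1 z ∂halfSpace μ := by
  have hset : MeasurableSet {b : (Y × X) × (X × ℝ) | b.2 ∈ cone b.1.2} :=
    (show Measurable fun b : (Y × X) × (X × ℝ) => (b.1.2, b.2) by fun_prop)
      measurableSet_setOf_mem_cone
  have hmeas : Measurable ({b : (Y × X) × (X × ℝ) | b.2 ∈ cone b.1.2}.indicator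
      fun b => g b.1.1 b.2) :=
    (hg.comp (show Measurable fun b : (Y × X) × (X × ℝ) => (b.1.1, b.2) by fun_prop)).indicator hset
  convert hmeas.lintegral_prod_right' (ν := halfSpace μ) using 2 with a
  rw [← lintegral_indicator (measurableSet_cone a.2)]
  rfl

/-- Tonelli, after replacing the density by a measurable representative; the exceptional null set
depends on neither x nor τ. -/
theorem lintegral_kernel_swap {φ : ℝ → ℝ≥0∞} (hφ : Measurable φ) (hf : MemL0 μ f) (P : ℝ) :
    ∫⁻ τ, ∫⁻ x, (∫⁻ z in cone x, φ (z.2 / τ) * weightedDensity n q σ f z ∂halfSpace μ) ^ P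
        ∂μ ∂dtOverT
      = ∫⁻ x, ∫⁻ τ, (∫⁻ z in cone x, φ (z.2 / τ) * weightedDensity n q σ f z ∂halfSpace μ) ^ P
        ∂dtOverT ∂μ := by
  obtain ⟨w, hw, hfw⟩ := hf.aemeasurable_weightedDensity (n := n) (q := q) (σ := σ)
  have hcongr (τ : ℝ) (x : X) :
      ∫⁻ z in cone x, φ (z.2 / τ) * weightedDensity n q σ f z ∂halfSpace μ
        = ∫⁻ z in cone x, φ (z.2 / τ) * w z ∂halfSpace μ := by
    refine lintegral_congr_ae ((ae_restrict_of_ae hfw).mono fun z hz => ?_)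
    simp only [hz]
  simp_rw [hcongr]
  refine lintegral_lintegral_swap (Measurable.aemeasurable ?_)
  refine (measurable_lintegral_cone (μ := μ) (g := fun τ z => φ (z.2 / τ) * w z) ?_).pow_const P
  unfold Function.uncurry
  fun_prop

theorem tsum_layers_swap (hf : MemL0 μ f) (P : ℝ) :
    ∑' k : ℤ, ∫⁻ x, (∫⁻ z in Prod.snd ⁻¹' Ioo (r ^ (k - 1)) (r ^ k), weightedDensity n q σ f z
        ∂((halfSpace μ).restrict (cone x))) ^ P ∂μ
      = ∫⁻ x, ∑' k : ℤ, (∫⁻ z in Prod.snd ⁻¹' Ioo (r ^ (k - 1)) (r ^ k), weightedDensity n q σ f z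
        ∂((halfSpace μ).restrict (cone x))) ^ P ∂μ := by
  obtain ⟨w, hw, hfw⟩ := hf.aemeasurable_weightedDensity (n := n) (q := q) (σ := σ)
  refine (lintegral_tsum fun k => Measurable.aemeasurable (Measurable.pow_const ?_ P)).symm
  have hS : MeasurableSet (Prod.snd ⁻¹' Ioo (r ^ (k - 1)) (r ^ k) : Set (X × ℝ)) :=
    measurable_snd measurableSet_Ioo
  have hcongr (x : X) : ∫⁻ z in Prod.snd ⁻¹' Ioo (r ^ (k - 1)) (r ^ k), weightedDensity n q σ f z
        ∂((halfSpace μ).restrict (cone x))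
      = ∫⁻ z in cone x, (Prod.snd ⁻¹' Ioo (r ^ (k - 1)) (r ^ k) : Set (X × ℝ)).indicator w z
        ∂halfSpace μ := by
    rw [lintegral_indicator hS]
    exact lintegral_congr_ae (ae_restrict_of_ae (ae_restrict_of_ae hfw))
  simp_rw [hcongr]
  exact (measurable_lintegral_cone (μ := μ) (Y := Unit)
    (g := fun _ => (Prod.snd ⁻¹' Ioo (r ^ (k - 1)) (r ^ k) : Set (X × ℝ)).indicator w)
    ((hw.indicator hS).comp measurable_snd)).comp (measurable_prodMk_left (x := ()))

end DiscreteNorm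

/-! ### Power identities -/

/-- Since σ = s₀ + θ(s₁ - s₀), the weight splits into a dilation-invariant kernel in t/τ and a power
of t that does not involve τ. -/
theorem rpow_neg_mul_rpow_eq {t τ : ℝ} (ht : 0 < t) (hτ : 0 < τ) (n q s₀ s₁ θ : ℝ) :
    (τ ^ (-(n * (s₁ - s₀) * θ))) ^ q * t ^ (n * (-q * s₀ - 1))
      = (t / τ) ^ (n * (s₁ - s₀) * θ * q) * t ^ (-(n * (((1 - θ) * s₀ + θ * s₁) * q + 1))) := by
  obtain ⟨a, rfl⟩ : ∃ a, Real.exp a = t := ⟨_, Real.exp_log ht⟩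
  obtain ⟨b, rfl⟩ : ∃ b, Real.exp b = τ := ⟨_, Real.exp_log hτ⟩
  simp only [← Real.exp_sub, ← Real.exp_mul, ← Real.exp_add]
  congr 1
  ring

theorem rpow_mul_rpow_eq {t τ : ℝ} (ht : 0 < t) (hτ : 0 < τ) (n q s₀ s₁ θ : ℝ) :
    (τ ^ (n * (s₁ - s₀) * (1 - θ))) ^ q * t ^ (n * (-q * s₁ - 1))
      = (t / τ) ^ (-(n * (s₁ - s₀) * (1 - θ) * q)) *
        t ^ (-(n * (((1 - θ) * s₀ + θ * s₁) * q + 1))) := by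
  obtain ⟨a, rfl⟩ : ∃ a, Real.exp a = t := ⟨_, Real.exp_log ht⟩
  obtain ⟨b, rfl⟩ : ∃ b, Real.exp b = τ := ⟨_, Real.exp_log hτ⟩
  simp only [← Real.exp_sub, ← Real.exp_mul, ← Real.exp_add]
  congr 1
  ring

/-- With α = τ^{n(s₁-s₀)} the two weights inside the minimum agree exactly at t = τ, so the minimum
is again a function of t/τ times the common density. -/
theorem rpow_mul_min_rpow_eq {t τ : ℝ} (ht : 0 < t) (hτ : 0 < τ) (n q s₀ s₁ θ : ℝ) :
    ((τ ^ (n * (s₁ - s₀))) ^ (-θ)) ^ q *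
        min (t ^ (n * (-q * s₀ - 1))) ((τ ^ (n * (s₁ - s₀))) ^ q * t ^ (n * (-q * s₁ - 1)))
      = min ((t / τ) ^ (n * (s₁ - s₀) * θ * q)) ((t / τ) ^ (-(n * (s₁ - s₀) * (1 - θ) * q))) *
        t ^ (-(n * (((1 - θ) * s₀ + θ * s₁) * q + 1))) := by
  rw [mul_min_of_nonneg _ _ (by positivity), min_mul_of_nonneg _ _ (by positivity),
    ← rpow_neg_mul_rpow_eq ht hτ, ← rpow_mul_rpow_eq ht hτ]
  obtain ⟨a, rfl⟩ : ∃ a, Real.exp a = t := ⟨_, Real.exp_log ht⟩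
  obtain ⟨b, rfl⟩ : ∃ b, Real.exp b = τ := ⟨_, Real.exp_log hτ⟩
  simp only [← Real.exp_mul, ← Real.exp_add]
  congr 2 <;> ring

theorem rpow_neg_abs_le_rpow {R u : ℝ} (hR : 1 ≤ R) (hu₁ : R⁻¹ ≤ u) (hu₂ : u ≤ R) (a : ℝ) :
    R ^ (-|a|) ≤ u ^ a := by
  have hR0 : 0 < R := by linarith
  have hu : 0 < u := (inv_pos.2 hR0).trans_le hu₁
  rcases le_total 0 a with ha | ha
  · rw [abs_of_nonneg ha, Real.rpow_neg hR0.le, ← Real.inv_rpow hR0.le]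
    exact Real.rpow_le_rpow (by positivity) hu₁ ha
  · rw [abs_of_nonpos ha, neg_neg]
    exact Real.rpow_le_rpow_of_nonpos hu hu₂ ha

theorem rpow_le_rpow_abs {R u : ℝ} (hR : 1 ≤ R) (hu₁ : R⁻¹ ≤ u) (hu₂ : u ≤ R) (a : ℝ) :
    u ^ a ≤ R ^ |a| := by
  have hR0 : 0 < R := by linarith
  have hu : 0 < u := (inv_pos.2 hR0).trans_le hu₁
  have := rpow_neg_abs_le_rpow hR hu₁ hu₂ (-a)
  rw [abs_neg, Real.rpow_neg hR0.le, Real.rpow_neg hu.le] at this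
  exact (inv_le_inv₀ (by positivity) (by positivity)).1 this

theorem comparable_rpow_one {R u : ℝ} (hR : 1 ≤ R) (hu₁ : R⁻¹ ≤ u) (hu₂ : u ≤ R) (a : ℝ) :
    Comparable (R ^ |a|).toNNReal (ENNReal.ofReal (u ^ a)) 1 := by
  have hR0 : 0 < R := by linarith
  have h := rpow_neg_abs_le_rpow hR hu₁ hu₂ a
  rw [Real.rpow_neg hR0.le] at h
  change _ ≤ ENNReal.ofReal _ * 1 ∧ 1 ≤ ENNReal.ofReal _ * _
  constructor
  · rw [mul_one]
    exact ENNReal.ofReal_le_ofReal (rpow_le_rpow_abs hR hu₁ hu₂ a)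
  · rw [← ENNReal.ofReal_mul (by positivity), ENNReal.one_le_ofReal]
    rwa [← inv_le_iff_one_le_mul₀' (by positivity)]

/-! ### Comparison of the tent space and interpolation quasi-norms with the discrete one -/

theorem lpNorm_rpow {Z : Type*} [MeasurableSpace Z] (ν : Measure Z) {p : ℝ} (hp : 0 < p)
    (g : Z → ℝ≥0∞) : lpNorm ν p g ^ p = ∫⁻ z, g z ^ p ∂ν := by
  rw [lpNorm, ← ENNReal.rpow_mul, one_div_mul_cancel hp.ne', ENNReal.rpow_one]

theorem mul_rpow_one_div_rpow {p q : ℝ} (hp : 0 < p) (hq : 0 < q) (c a : ℝ≥0∞) :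
    (c * a ^ (1 / q)) ^ p = (c ^ q * a) ^ (p / q) := by
  have hpq : 0 ≤ p / q := by positivity
  rw [ENNReal.mul_rpow_of_nonneg _ _ hp.le, ENNReal.mul_rpow_of_nonneg _ _ hpq,
    ← ENNReal.rpow_mul, ← ENNReal.rpow_mul, one_div_mul_eq_div, mul_div_cancel₀ _ hq.ne']

section Main

variable {X : Type*} [MetricSpace X] [MeasurableSpace X] [BorelSpace X] {μ : Measure X}
  {n p q s₀ s₁ θ : ℝ}

/-- The volume becomes t^n at the cost of a constant. The prefactor c stands for the powers of τ or
r^k; being finite, it can be carried inside the cone integral, where it combines with the power of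
t. -/
theorem IsADRegular.exists_comparable_tentNorm (hAD : IsADRegular μ n)
    (hX : ¬ Bornology.IsBounded (univ : Set X)) (hp : 0 < p) (hq : 0 < q) (s : ℝ) :
    ∃ C : ℝ≥0, ∀ (c : ℝ≥0∞) (g : X × ℝ → ℂ), c ≠ ∞ →
      Comparable C ((c * tentNorm μ p q s g) ^ p)
        (∫⁻ x, (∫⁻ z in cone x, c ^ q * (‖g z‖ₑ ^ q * ENNReal.ofReal (z.2 ^ (n * (-q * s - 1))))
          ∂halfSpace μ) ^ (p / q) ∂μ) := by
  have := hAD.secondCountableTopology hX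
  obtain ⟨C, -, hC⟩ := hAD.exists_comparable_rpow hX (-q * s - 1)
  refine ⟨C ^ (p / q), fun c g hc => ?_⟩
  -- On the cone the volume is positive and finite, so its real and extended powers agree and
  -- |V^{-s}g|^q / V = |g|^q V^{-qs-1}.
  have hlusin (x : X) : lusin μ q (volPow μ (-s) g) x
      = (∫⁻ z in cone x, ‖g z‖ₑ ^ q * μ (Metric.ball z.1 z.2) ^ (-q * s - 1) ∂halfSpace μ)
        ^ (1 / q) := by
    unfold lusin volPow
    congr 1
    refine setLIntegral_congr_fun (measurableSet_cone x) fun z hz => ?_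
    have hpos := hAD.measure_ball_pos hX z.1 hz.1
    have htop := hAD.measure_ball_ne_top hX z.1 z.2
    have hreal : 0 < μ.real (Metric.ball z.1 z.2) := ENNReal.toReal_pos hpos.ne' htop
    have hnorm : ‖((μ.real (Metric.ball z.1 z.2) ^ (-s) : ℝ) : ℂ)‖ₑ
        = μ (Metric.ball z.1 z.2) ^ (-s) := by
      rw [← ofReal_norm, Complex.norm_real, Real.norm_of_nonneg (by positivity),
        ← ENNReal.ofReal_rpow_of_pos hreal, Measure.real, ENNReal.ofReal_toReal htop]
    change ‖_ * g z‖ₑ ^ q / _ = _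
    rw [enorm_mul, hnorm, ENNReal.mul_rpow_of_nonneg _ _ hq.le, ← ENNReal.rpow_mul,
      sub_eq_add_neg, ENNReal.rpow_add _ _ hpos.ne' htop, ENNReal.rpow_neg_one,
      ENNReal.div_eq_inv_mul]
    rw [show -s * q = -q * s by ring]
    ring
  have hcp : c ^ p ≠ ∞ := ENNReal.rpow_ne_top_of_nonneg hp.le hc
  have hcq : c ^ q ≠ ∞ := ENNReal.rpow_ne_top_of_nonneg hq.le hc
  rw [ENNReal.mul_rpow_of_nonneg _ _ hp.le, tentNorm, lpNorm_rpow μ hp,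
    ← lintegral_const_mul' _ _ hcp]
  refine Comparable.lintegral (Eventually.of_forall fun x => ?_)
  rw [hlusin, ← ENNReal.mul_rpow_of_nonneg _ _ hp.le, mul_rpow_one_div_rpow hp hq,
    ← lintegral_const_mul' _ _ hcq]
  refine Comparable.rpow (Comparable.lintegral ?_) (by positivity)
  filter_upwards [ae_restrict_mem (measurableSet_cone x)] with z hz
  exact ((hC z.1 z.2 hz.1).mul_left _).mul_left _

/-- A truncated tent space average is comparable to the discrete quasi-norm as soon as its
integrand is given by an admissible kernel. -/
theorem IsADRegular.exists_comparable_truncation (hAD : IsADRegular μ n)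
    (hX : ¬ Bornology.IsBounded (univ : Set X)) (hp : 0 < p) (hq : 0 < q) {r : ℝ} (hr : 1 < r)
    (s σ : ℝ) {φ : ℝ → ℝ≥0∞} (hφm : Measurable φ) {c d : ℝ} {η : ℝ≥0}
    (hc : 0 < c) (hd : 0 < d) (hφc : ∀ u, 0 < u → φ u ≤ ENNReal.ofReal (u ^ c))
    (hφd : ∀ u, 0 < u → φ u ≤ ENNReal.ofReal (u ^ (-d))) (hη : 0 < η) (i : ℤ)
    (hφ : ∀ u, r ^ (i - 1) < u → u < r ^ (i + 1) → η ≤ φ u)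
    (b : ℝ → ℝ) (S : ℝ → (X × ℝ → ℂ) → X × ℝ → ℂ)
    (hS : ∀ (τ : ℝ) (f : X × ℝ → ℂ) (z : X × ℝ), 0 < τ → 0 < z.2 →
      ENNReal.ofReal (b τ) ^ q * (‖S τ f z‖ₑ ^ q * ENNReal.ofReal (z.2 ^ (n * (-q * s - 1))))
        = φ (z.2 / τ) * weightedDensity n q σ f z) :
    NormEquiv μ (fun f => lpNorm dtOverT p fun τ => ENNReal.ofReal (b τ) * tentNorm μ p q s (S τ f))
      (discreteNorm μ n p q σ r) := by
  have := hAD.secondCountableTopology hX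
  have := hAD.sigmaFinite hX
  obtain ⟨C, hC⟩ := exists_comparable_kernel_discreteNorm μ n σ hr hp hq hc hd hφc hφd hη i hφ
  obtain ⟨D, hD⟩ := hAD.exists_comparable_tentNorm hX hp hq s
  refine normEquiv_of_comparable (D ^ (1 / p) * C) fun f hf => Comparable.trans ?_ (hC f)
  rw [← lintegral_kernel_swap hφm hf]
  refine Comparable.rpow (Comparable.lintegral ?_) (by positivity)
  filter_upwards [ae_dtOverT_pos] with τ hτ
  convert hD (ENNReal.ofReal (b τ)) (S τ f) ENNReal.ofReal_ne_top using 3 with x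
  congr 1
  exact setLIntegral_congr_fun (measurableSet_cone x) fun z hz => (hS τ f z hτ hz.1).symm

theorem IsADRegular.lowerTruncNorm_equiv (hAD : IsADRegular μ n)
    (hX : ¬ Bornology.IsBounded (univ : Set X)) (hp : 0 < p) (hq : 0 < q) (hs : s₀ < s₁)
    (hθ : 0 < θ) {r : ℝ} (hr : 1 < r) :
    NormEquiv μ (lowerTruncNorm μ n p q s₀ s₁ θ)
      (discreteNorm μ n p q ((1 - θ) * s₀ + θ * s₁) r) := by
  have hr0 : 0 < r := by linarith
  set a := n * (s₁ - s₀) * θ * q with ha_def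
  have ha : 0 < a := mul_pos (mul_pos (mul_pos hAD.1 (sub_pos.2 hs)) hθ) hq
  set φ : ℝ → ℝ≥0∞ := (Iio 1).indicator fun u => ENNReal.ofReal (u ^ a) with hφ_def
  -- The kernel vanishes for u ≥ 1, so any decay rate at ∞ will do, here d = 1. The choice i = -1
  -- places the window (r^{-2}, 1) inside its support.
  refine hAD.exists_comparable_truncation hX hp hq hr s₀ ((1 - θ) * s₀ + θ * s₁) (φ := φ)
    ((by fun_prop : Measurable fun u : ℝ => ENNReal.ofReal (u ^ a)).indicator measurableSet_Iio)
    (c := a) (d := 1) (η := ((r ^ 2) ^ (-|a|)).toNNReal) ha one_pos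
    (fun u _ => indicator_le_self _ _ u) (fun u hu => ?_)
    (Real.toNNReal_pos.2 (by positivity)) (-1) (fun u hu₁ hu₂ => ?_) _ _ ?_
  · refine indicator_apply_le' (fun hu1 => ?_) fun _ => zero_le
    refine ENNReal.ofReal_le_ofReal ((Real.rpow_le_one hu.le (le_of_lt hu1) ha.le).trans ?_)
    rw [Real.rpow_neg_one]
    exact (one_le_inv₀ hu).2 (le_of_lt hu1)
  · have hu1 : u < 1 := by simpa using hu₂
    rw [hφ_def, indicator_of_mem (show u ∈ Iio 1 from hu1)]
    refine ENNReal.ofReal_le_ofReal (rpow_neg_abs_le_rpow (by nlinarith) ?_ (by nlinarith) a)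
    refine le_of_eq_of_le ?_ hu₁.le
    norm_num
  · intro τ f z hτ hz
    have htrunc : ENNReal.ofReal z.2 < ENNReal.ofReal τ ↔ z.2 / τ < 1 := by
      rw [ENNReal.ofReal_lt_ofReal_iff hτ, div_lt_one hτ]
    by_cases h : z.2 / τ < 1
    · have hmem : z ∈ {z : X × ℝ | 0 < ENNReal.ofReal z.2 ∧ ENNReal.ofReal z.2 < ENNReal.ofReal τ} :=
        ⟨ENNReal.ofReal_pos.2 hz, htrunc.2 h⟩
      rw [hφ_def, indicator_of_mem (show z.2 / τ ∈ Iio 1 from h), truncate, indicator_of_mem hmem,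
        weightedDensity, mul_left_comm, mul_left_comm _ (‖f z‖ₑ ^ q),
        ENNReal.ofReal_rpow_of_pos (by positivity), ← ENNReal.ofReal_mul (by positivity),
        ← ENNReal.ofReal_mul (by positivity), rpow_neg_mul_rpow_eq hz hτ]
    · have hmem : z ∉ {z : X × ℝ | 0 < ENNReal.ofReal z.2 ∧ ENNReal.ofReal z.2 < ENNReal.ofReal τ} :=
        fun h' => h (htrunc.1 h'.2)
      rw [hφ_def, indicator_of_notMem (show z.2 / τ ∉ Iio 1 from h), truncate,
        indicator_of_notMem hmem]
      simp [hq]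

theorem IsADRegular.upperTruncNorm_equiv (hAD : IsADRegular μ n)
    (hX : ¬ Bornology.IsBounded (univ : Set X)) (hp : 0 < p) (hq : 0 < q) (hs : s₀ < s₁)
    (hθ : θ < 1) {r : ℝ} (hr : 1 < r) :
    NormEquiv μ (upperTruncNorm μ n p q s₀ s₁ θ)
      (discreteNorm μ n p q ((1 - θ) * s₀ + θ * s₁) r) := by
  have hr0 : 0 < r := by linarith
  set b := n * (s₁ - s₀) * (1 - θ) * q with hb_def
  have hb : 0 < b := mul_pos (mul_pos (mul_pos hAD.1 (sub_pos.2 hs)) (sub_pos.2 hθ)) hq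
  set φ : ℝ → ℝ≥0∞ := (Ioi 1).indicator fun u => ENNReal.ofReal (u ^ (-b)) with hφ_def
  -- Mirror image of the lower truncation: the kernel vanishes for u ≤ 1, and i = 1 gives the window
  -- (1, r²).
  refine hAD.exists_comparable_truncation hX hp hq hr s₁ ((1 - θ) * s₀ + θ * s₁) (φ := φ)
    ((by fun_prop : Measurable fun u : ℝ => ENNReal.ofReal (u ^ (-b))).indicator measurableSet_Ioi)
    (c := 1) (d := b) (η := ((r ^ 2) ^ (-|-b|)).toNNReal) one_pos hb
    (fun u hu => ?_) (fun u _ => indicator_le_self _ _ u)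
    (Real.toNNReal_pos.2 (by positivity)) 1 (fun u hu₁ hu₂ => ?_) _ _ ?_
  · refine indicator_apply_le' (fun hu1 => ?_) fun _ => zero_le
    have hu1 : 1 < u := hu1
    refine ENNReal.ofReal_le_ofReal
      ((Real.rpow_le_one_of_one_le_of_nonpos hu1.le (by linarith)).trans ?_)
    rw [Real.rpow_one]
    exact hu1.le
  · have hu1 : 1 < u := by simpa using hu₁
    rw [hφ_def, indicator_of_mem (show u ∈ Ioi 1 from hu1)]
    refine ENNReal.ofReal_le_ofReal (rpow_neg_abs_le_rpow (by nlinarith) ?_ ?_ (-b))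
    · exact (inv_le_one_of_one_le₀ (by nlinarith)).trans hu1.le
    · refine hu₂.le.trans_eq ?_
      norm_num
  · intro τ f z hτ hz
    have htrunc : ENNReal.ofReal τ < ENNReal.ofReal z.2 ↔ 1 < z.2 / τ := by
      rw [ENNReal.ofReal_lt_ofReal_iff hz, one_lt_div hτ]
    by_cases h : 1 < z.2 / τ
    · have hmem : z ∈ {z : X × ℝ | ENNReal.ofReal τ < ENNReal.ofReal z.2 ∧ ENNReal.ofReal z.2 < ∞} :=
        ⟨htrunc.2 h, ENNReal.ofReal_lt_top⟩
      rw [hφ_def, indicator_of_mem (show z.2 / τ ∈ Ioi 1 from h), truncate, indicator_of_mem hmem,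
        weightedDensity, mul_left_comm, mul_left_comm _ (‖f z‖ₑ ^ q),
        ENNReal.ofReal_rpow_of_pos (by positivity), ← ENNReal.ofReal_mul (by positivity),
        ← ENNReal.ofReal_mul (by positivity), rpow_mul_rpow_eq hz hτ]
    · have hmem : z ∉ {z : X × ℝ | ENNReal.ofReal τ < ENNReal.ofReal z.2 ∧ ENNReal.ofReal z.2 < ∞} :=
        fun h' => h (htrunc.1 h'.1)
      rw [hφ_def, indicator_of_notMem (show z.2 / τ ∉ Ioi 1 from h), truncate,
        indicator_of_notMem hmem]
      simp [hq]

/-- The k-th term sees only the k-th layer, where t/r^k lies in (1/r, 1) and any fixed power of it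
is comparable to 1. The comparison is therefore term by term, whatever the order of s₀ and s₁. -/
theorem IsADRegular.layerNorm_equiv (hAD : IsADRegular μ n)
    (hX : ¬ Bornology.IsBounded (univ : Set X)) (hp : 0 < p) (hq : 0 < q) (s₀ s₁ θ : ℝ)
    {r : ℝ} (hr : 1 < r) :
    NormEquiv μ (layerNorm μ n p q s₀ s₁ θ r)
      (discreteNorm μ n p q ((1 - θ) * s₀ + θ * s₁) r) := by
  have := hAD.secondCountableTopology hX
  have := hAD.sigmaFinite hX
  have hr0 : 0 < r := by linarith
  set a := n * (s₁ - s₀) * θ * q with ha_def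
  obtain ⟨D, hD⟩ := hAD.exists_comparable_tentNorm hX hp hq s₀
  set E : ℝ≥0 := (r ^ |a|).toNNReal ^ (p / q) with hE
  refine normEquiv_of_comparable ((D * E) ^ (1 / p)) fun f hf => ?_
  unfold layerNorm discreteNorm
  rw [← tsum_layers_swap hf]
  refine Comparable.rpow (Comparable.tsum fun k => (hD _ _ ENNReal.ofReal_ne_top).trans ?_)
    (by positivity)
  have hS : MeasurableSet (Prod.snd ⁻¹' Ioo (r ^ (k - 1)) (r ^ k) : Set (X × ℝ)) :=
    measurable_snd measurableSet_Ioo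
  have hk : 0 < r ^ k := zpow_pos hr0 k
  refine Comparable.lintegral (Eventually.of_forall fun x => ?_)
  refine Comparable.rpow ?_ (by positivity)
  rw [← lintegral_indicator hS]
  refine Comparable.lintegral ?_
  filter_upwards [ae_restrict_mem (measurableSet_cone x)] with z hz
  have hz0 : 0 < z.2 := hz.1
  have htrunc : z ∈ {z : X × ℝ | ENNReal.ofReal (r ^ (k - 1)) < ENNReal.ofReal z.2 ∧
      ENNReal.ofReal z.2 < ENNReal.ofReal (r ^ k)} ↔
      z ∈ (Prod.snd ⁻¹' Ioo (r ^ (k - 1)) (r ^ k) : Set (X × ℝ)) := by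
    rw [mem_ofPred_eq, ENNReal.ofReal_lt_ofReal_iff hz0, ENNReal.ofReal_lt_ofReal_iff hk]
    rfl
  by_cases h : z ∈ (Prod.snd ⁻¹' Ioo (r ^ (k - 1)) (r ^ k) : Set (X × ℝ))
  · have hu₁ : r⁻¹ ≤ z.2 / r ^ k := by
      rw [le_div_iff₀ hk, ← zpow_neg_one, ← zpow_add₀ hr0.ne', neg_add_eq_sub]
      exact h.1.le
    have hu₂ : z.2 / r ^ k ≤ r := ((div_lt_one hk).2 h.2).le.trans hr.le
    have hpow : r ^ (-(n * k * θ * (s₁ - s₀))) = (r ^ k) ^ (-(n * (s₁ - s₀) * θ)) := by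
      rw [← Real.rpow_intCast, ← Real.rpow_mul hr0.le]
      congr 1
      ring
    rw [indicator_of_mem h, truncate, indicator_of_mem (htrunc.2 h), weightedDensity,
      mul_left_comm, hpow, ENNReal.ofReal_rpow_of_pos (by positivity),
      ← ENNReal.ofReal_mul (by positivity), rpow_neg_mul_rpow_eq hz0 hk,
      ENNReal.ofReal_mul (by positivity)]
    refine Comparable.mul_left ?_ _
    simpa using (comparable_rpow_one hr.le hu₁ hu₂ a).mul Comparable.rfl
  · rw [indicator_of_notMem h, truncate, indicator_of_notMem (mt htrunc.1 h)]
    simp [hq, Comparable]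

theorem IsADRegular.exists_comparable_kFunctional_cone (hAD : IsADRegular μ n)
    (hX : ¬ Bornology.IsBounded (univ : Set X)) (hq : 0 < q) (s₀ s₁ : ℝ) :
    ∃ C : ℝ≥0, ∀ (f : X × ℝ → ℂ) (x : X) (α : ℝ), MemL0 μ f → 0 < α →
      Comparable C
        (kFunctional (halfSpace μ) (lqsNorm μ q s₀) (lqsNorm μ q s₁) α ((cone x).indicator f))
        ((∫⁻ z in cone x, ‖f z‖ₑ ^ q * ENNReal.ofReal (min (z.2 ^ (n * (-q * s₀ - 1)))
          (α ^ q * z.2 ^ (n * (-q * s₁ - 1)))) ∂halfSpace μ) ^ (1 / q)) := by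
  have := hAD.secondCountableTopology hX
  have := hAD.sigmaFinite hX
  obtain ⟨C₀, -, hC₀⟩ := hAD.exists_comparable_rpow hX (-q * s₀ - 1)
  obtain ⟨C₁, -, hC₁⟩ := hAD.exists_comparable_rpow hX (-q * s₁ - 1)
  refine ⟨2 * 2 ^ (1 / q) * (max C₀ C₁) ^ (1 / q), fun f x α hf hα => ?_⟩
  refine (comparable_kFunctional (halfSpace μ)
    ((measurable_measure_ball μ).pow_const (-q * s₀ - 1))
    ((measurable_measure_ball μ).pow_const (-q * s₁ - 1)) hq hα
    (AEStronglyMeasurable.indicator hf (measurableSet_cone x))).trans ?_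
  refine Comparable.rpow ?_ (by positivity)
  rw [← lintegral_indicator (measurableSet_cone x)]
  refine Comparable.lintegral (Eventually.of_forall fun z => ?_)
  by_cases hz : z ∈ cone x
  · rw [indicator_of_mem hz, indicator_of_mem hz,
      (ENNReal.ofReal_mono.map_min : ENNReal.ofReal (min _ _) = _),
      ENNReal.ofReal_mul (by positivity)]
    exact ((hC₀ z.1 z.2 hz.1).min ((hC₁ z.1 z.2 hz.1).mul_left _)).mul_left _
  · rw [indicator_of_notMem hz, indicator_of_notMem hz]
    simp [hq, Comparable]

/-- After the K-functional is computed on each cone, the substitution α = τ^{n(s₁-s₀)} turns the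
interpolation integral into a kernel average. -/
theorem IsADRegular.coneInterpNorm_equiv (hAD : IsADRegular μ n)
    (hX : ¬ Bornology.IsBounded (univ : Set X)) (hp : 0 < p) (hq : 0 < q) (hs : s₀ ≠ s₁)
    (hθ₀ : 0 < θ) (hθ₁ : θ < 1) {r : ℝ} (hr : 1 < r) :
    NormEquiv μ (coneInterpNorm μ p q s₀ s₁ θ)
      (discreteNorm μ n p q ((1 - θ) * s₀ + θ * s₁) r) := by
  have := hAD.secondCountableTopology hX
  have := hAD.sigmaFinite hX
  have hr0 : 0 < r := by linarith
  have hn := hAD.1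
  set δ := n * (s₁ - s₀) with hδ_def
  have hδ : δ ≠ 0 := mul_ne_zero hn.ne' (sub_ne_zero.2 hs.symm)
  set a := δ * θ * q with ha_def
  set b := δ * (1 - θ) * q with hb_def
  set φ : ℝ → ℝ≥0∞ := fun u => ENNReal.ofReal (min (u ^ a) (u ^ (-b))) with hφ_def
  have hφa (u : ℝ) : φ u ≤ ENNReal.ofReal (u ^ a) := ENNReal.ofReal_le_ofReal (min_le_left _ _)
  have hφb (u : ℝ) : φ u ≤ ENNReal.ofReal (u ^ (-b)) := ENNReal.ofReal_le_ofReal (min_le_right _ _)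
  -- For δ < 0 both a and b are negative and the two powers exchange roles: u^{-b} gives the decay
  -- at 0 and u^a the decay at ∞.
  have hdecay : ∃ c d : ℝ, 0 < c ∧ 0 < d ∧ (∀ u, φ u ≤ ENNReal.ofReal (u ^ c)) ∧
      ∀ u, φ u ≤ ENNReal.ofReal (u ^ (-d)) := by
    have hθ' : 0 < 1 - θ := by linarith
    rcases hδ.lt_or_gt with h | h
    · refine ⟨-b, -a, ?_, ?_, hφb, by simpa using hφa⟩
      · have := mul_pos (mul_pos (neg_pos.2 h) hθ') hq
        rw [hb_def]
        linarith
      · have := mul_pos (mul_pos (neg_pos.2 h) hθ₀) hq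
        rw [ha_def]
        linarith
    · exact ⟨a, b, mul_pos (mul_pos h hθ₀) hq, mul_pos (mul_pos h hθ') hq, hφa, hφb⟩
  obtain ⟨c, d, hc, hd, hφc, hφd⟩ := hdecay
  obtain ⟨C, hC⟩ := exists_comparable_kernel_discreteNorm μ n ((1 - θ) * s₀ + θ * s₁) hr hp hq hc hd
    (fun u _ => hφc u) (fun u _ => hφd u)
    (η := (min (r ^ (-|a|)) (r ^ (-|-b|))).toNNReal)
    (Real.toNNReal_pos.2 (lt_min (by positivity) (by positivity))) 0 (fun u hu₁ hu₂ => by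
      have hu₁' : r⁻¹ ≤ u := by simpa using hu₁.le
      have hu₂' : u ≤ r := by simpa using hu₂.le
      exact ENNReal.ofReal_le_ofReal (min_le_min (rpow_neg_abs_le_rpow hr.le hu₁' hu₂' a)
        (rpow_neg_abs_le_rpow hr.le hu₁' hu₂' (-b))))
  obtain ⟨D, hD⟩ := hAD.exists_comparable_kFunctional_cone hX hq s₀ s₁
  have hδ' : 0 < |δ| := abs_pos.2 hδ
  -- The maximum of |δ| and its inverse absorbs the Jacobian of the substitution in both directions.
  refine normEquiv_of_comparable ((D ^ p * max |δ|.toNNReal |δ|⁻¹.toNNReal) ^ (1 / p) * C)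
    fun f hf => Comparable.trans ?_ (hC f)
  refine Comparable.rpow (Comparable.lintegral (Eventually.of_forall fun x => ?_)) (by positivity)
  unfold realInterpNorm
  rw [lpNorm_rpow _ hp]
  refine Comparable.trans (Comparable.lintegral (C := D ^ p) (ν := dtOverT) (h := fun α =>
    (∫⁻ z in cone x, ENNReal.ofReal ((α ^ (-θ)) ^ q) * (‖f z‖ₑ ^ q *
      ENNReal.ofReal (min (z.2 ^ (n * (-q * s₀ - 1)))
          (α ^ q * z.2 ^ (n * (-q * s₁ - 1))))) ∂halfSpace μ) ^ (p / q)) ?_) ?_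
  · filter_upwards [ae_dtOverT_pos] with α hα
    have h := ((hD f x α hf hα).mul_left (ENNReal.ofReal (α ^ (-θ)))).rpow hp.le
    rwa [mul_rpow_one_div_rpow hp hq, ENNReal.ofReal_rpow_of_pos (by positivity),
      ← lintegral_const_mul' _ _ ENNReal.ofReal_ne_top] at h
  · rw [lintegral_dtOverT_comp_rpow hδ]
    have hkernel : ∫⁻ τ, (∫⁻ z in cone x, ENNReal.ofReal (((τ ^ δ) ^ (-θ)) ^ q) * (‖f z‖ₑ ^ q *
        ENNReal.ofReal (min (z.2 ^ (n * (-q * s₀ - 1)))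
          ((τ ^ δ) ^ q * z.2 ^ (n * (-q * s₁ - 1))))) ∂halfSpace μ) ^ (p / q) ∂dtOverT
        = ∫⁻ τ, (∫⁻ z in cone x, φ (z.2 / τ) *
          weightedDensity n q ((1 - θ) * s₀ + θ * s₁) f z ∂halfSpace μ) ^ (p / q) ∂dtOverT := by
      refine lintegral_congr_ae ?_
      filter_upwards [ae_dtOverT_pos] with τ hτ
      congr 1
      refine setLIntegral_congr_fun (measurableSet_cone x) fun z hz => ?_
      have hz0 : 0 < z.2 := hz.1
      have hu : 0 < z.2 / τ := div_pos hz0 hτ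
      rw [weightedDensity, hφ_def]
      dsimp only
      rw [mul_left_comm, mul_left_comm _ (‖f z‖ₑ ^ q), ← ENNReal.ofReal_mul (by positivity),
        ← ENNReal.ofReal_mul (le_min (by positivity) (by positivity)),
        rpow_mul_min_rpow_eq hz0 hτ]
    rw [hkernel]
    constructor
    · gcongr
      exact ENNReal.coe_le_coe.2 (le_max_left _ _)
    · rw [← mul_assoc]
      refine le_mul_of_one_le_left zero_le ?_
      calc (1 : ℝ≥0∞) = ENNReal.ofReal |δ|⁻¹ * ENNReal.ofReal |δ| := by
            rw [← ENNReal.ofReal_mul (by positivity), inv_mul_cancel₀ hδ'.ne', ENNReal.ofReal_one]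
        _ ≤ _ := by
            gcongr
            exact ENNReal.coe_le_coe.2 (le_max_right _ _)

end Main

end TentSpace

end

/-! ### The equivalences, through the common discrete quasi-norm -/

open TentSpace in
theorem mainTheorem6 {X : Type*} [MetricSpace X] [MeasurableSpace X] [BorelSpace X]
    (μ : MeasureTheory.Measure X) (n : ℝ) (hAD : IsADRegular μ n)
    (hX : ¬ Bornology.IsBounded (Set.univ : Set X))
    (p₀ p₁ q s₀ s₁ θ pθ : ℝ) (hp₀ : 0 < p₀) (hp₁ : 0 < p₁) (hq : 0 < q) (hs : s₀ ≠ s₁)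
    (hθ₀ : 0 < θ) (hθ₁ : θ < 1) (hpθ : pθ⁻¹ = (1 - θ) * p₀⁻¹ + θ * p₁⁻¹) :
    (s₀ < s₁ →
      NormEquiv μ (coneInterpNorm μ pθ q s₀ s₁ θ) (upperTruncNorm μ n pθ q s₀ s₁ θ) ∧
      NormEquiv μ (coneInterpNorm μ pθ q s₀ s₁ θ) (lowerTruncNorm μ n pθ q s₀ s₁ θ)) ∧
    (s₁ < s₀ →
      NormEquiv μ (coneInterpNorm μ pθ q s₀ s₁ θ) (upperTruncNorm μ n pθ q s₁ s₀ (1 - θ)) ∧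
      NormEquiv μ (coneInterpNorm μ pθ q s₀ s₁ θ) (lowerTruncNorm μ n pθ q s₁ s₀ (1 - θ))) ∧
    (∀ r : ℝ, 1 < r →
      NormEquiv μ (coneInterpNorm μ pθ q s₀ s₁ θ) (layerNorm μ n pθ q s₀ s₁ θ r)) := by
  have hp : 0 < pθ := by
    have : 0 < 1 - θ := by linarith
    rw [← inv_pos, hpθ]
    positivity
  have hcone {r : ℝ} (hr : 1 < r) := hAD.coneInterpNorm_equiv hX hp hq hs hθ₀ hθ₁ hr
  -- Swapping s₀ with s₁ and θ with 1 - θ leaves σ unchanged, so both orders lead to the same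
  -- discrete quasi-norm. The base of its layers is free: 2 serves for the truncations, the given r
  -- for the layer norm.
  have hσ : (1 - (1 - θ)) * s₁ + (1 - θ) * s₀ = (1 - θ) * s₀ + θ * s₁ := by ring
  refine ⟨fun h => ⟨?_, ?_⟩, fun h => ⟨?_, ?_⟩, fun r hr => ?_⟩
  · exact (hcone one_lt_two).trans (hAD.upperTruncNorm_equiv hX hp hq h hθ₁ one_lt_two).symm
  · exact (hcone one_lt_two).trans (hAD.lowerTruncNorm_equiv hX hp hq h hθ₀ one_lt_two).symm
  · have := hAD.upperTruncNorm_equiv (θ := 1 - θ) hX hp hq h (by linarith) one_lt_two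
    rw [hσ] at this
    exact (hcone one_lt_two).trans this.symm
  · have := hAD.lowerTruncNorm_equiv (θ := 1 - θ) hX hp hq h (by linarith) one_lt_two
    rw [hσ] at this
    exact (hcone one_lt_two).trans this.symm
  · exact (hcone hr).trans (hAD.layerNorm_equiv hX hp hq s₀ s₁ θ hr).symm
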